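/- Let $F$ be a field of characteristic $0$, $\mathbb N=\{0,1,2,\dots\}$. A conformal superalgebra is a $\mathbb Z_2$-graded $F[\partial]$-module $R=R_0\oplus R_1$ with parity-preserving bilinear products $(u,v)\mapsto u_nv$ ($n\in\mathbb N$), written $Y^+(u,z)v=\sum_{n\ge 0}(u_nv)z^{-n-1}\in R[z^{-1}]z^{-1}$, such that for $u\in R_i$, $v\in R_j$ $$Y^+(\partial u,z)=\tfrac{d}{dz}Y^+(u,z),\qquad Y^+(u,z)v=(-1)^{ij}\,\mathrm{Res}_x\frac{e^{x\partial}Y^+(v,-x)u}{z-x},$$ $$Y^+(u,z_1)Y^+(v,z_2)-(-1)^{ij}Y^+(v,z_2)Y^+(u,z_1)=\mathrm{Res}_x\frac{Y^+(Y^+(u,z_1-x)v,x)}{z_2-x},$$ where binomials are expanded in nonnegative powers of the second variable. An ideal is a subspace $I$ with $\partial I\subseteq I$ and $u_nI\subseteq I$ for all $u\in R$, $n\in\mathbb N$; $R$ is simple if its only ideals are $\{0\}$ and $R$. $R$ is generated by $S\subseteq R$ if $R=\mathrm{span}\{u^1_{m_1}\cdots u^p_{m_p}v\mid u^j,v\in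 S;\ p,m_j\in\mathbb N\}$. Let $k_1,k_2\ge 1$, $k=k_1+k_2$, and let $A=A_0\oplus A_1=M_{k\times k}(F)$, where $A_0$ consists of the block diagonal and $A_1$ of the block off-diagonal matrices with respect to $k=k_1+k_2$. Let $N(A)$ be the space of $2\times2$ matrices, with rows and columns indexed by $\mathbb Z_2=\{0,1\}$, whose $(i,j)$ entry lies in $A_{i+j}$, and put $R(A)=N(A)\otimes F[t_1,t_2]$. For $u\in A_{i+j}$ let $u_{[i,j]}(m,n)$ be the matrix with $(i,j)$ entry $u$ and all other entries $0$, tensored with $t_1^mt_2^n$. On $R(A)$ put $\partial u_{[i,j]}(m,n)=(m+1)u_{[i,j]}(m+1,n)+(n+1)u_{[i,j]}(m,n+1)$ and $$\begin{aligned}Y^+(u_{[i_1,i_2]}(m_1,m_2),z)\,v_{[j_1,j_2]}(n_1,n_2)={}&\delta_{i_2,j_1}(n_1\delta_{i_2,0}+1)\tbinom{-n_1-1-\delta_{i_2,0}}{m_2}\sum_{p=0}^{P}\tbinom{p}{m_1}(uv)_{[i_1,j_2]}(p,n_2)\,z^{p-P-1}\\&-(-1)^{(i_1+i_2)(j_1+j_2)}\delta_{i_1,j_2}\big(\delta_{i_1,1}-(n_2+1)\delta_{i_1,0}\big)\tbinom{-n_2-1-\delta_{i_1,0}}{m_1}\sum_{q=0}^{Q}\tbinom{q}{m_2}(vu)_{[j_1,i_2]}(n_1,q)\,z^{q-Q-1},\end{aligned}$$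 with $P=m_1+m_2+n_1+\delta_{i_2,0}$ and $Q=m_1+m_2+n_2+\delta_{i_1,0}$. The element $u_{[i,j]}(m,n)$ has weight $m+n+\delta_{i,0}+\delta_{j,0}+(\delta_{i,1}+\delta_{j,1})/2$. With matrix units $E_{p,q}$ and $\ell\in\mathbb N$, let $R_{[k_1,k_2],\ell+1}=R_0+R_1\subseteq R(A)$, where, with $1\le p_1,q_1\le k_1$, $1\le p_2,q_2\le k_2$, $m,n\in\mathbb N$, $$R_0=\mathrm{span}\{(E_{p_1,q_1})_{[0,0]}(m,\ell+n),\ (E_{k_1+p_2,k_1+q_2})_{[1,1]}(m,\ell+n)\},$$ $$R_1=\mathrm{span}\{(E_{p_1,k_1+p_2})_{[0,1]}(m,\ell+n),\ (E_{k_1+p_2,p_1})_{[1,0]}(m,\ell+n)\}.$$ **Theorem.** For all $k_1,k_2\ge1$ and $\ell\ge0$, the space $R_{[k_1,k_2],\ell+1}$ with $\partial$ and $Y^+$ restricted from $R(A)$ is a conformal superalgebra with even part $R_0$ and odd part $R_1\ne\{0\}$, and it is simple. Its subspace of weight $\ell+\frac32$ is $$R_{[k_1,k_2],\ell+1}^{(\ell+3/2)}=\mathrm{span}\{(E_{p_1,k_1+p_2})_{[0,1]}(0,\ell),\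 (E_{k_1+p_2,p_1})_{[1,0]}(0,\ell)\mid 1\le p_1\le k_1,\ 1\le p_2\le k_2\}.$$ If $k>2$, then $R_{[k_1,k_2],\ell+1}$ is generated by this subspace. If $k=2$, it is generated by $$\{(E_{1,2})_{[0,1]}(0,\ell),\ (E_{2,1})_{[1,0]}(0,\ell),\ (E_{2,2})_{[1,1]}(0,\ell+1)\}.$$ -/

import Mathlib

namespace ConfSuper

/-! ### Conformal superalgebras -/

/-- The data `(R = R₀ + R₁, ∂, Y⁺(·,z))`; `Y n u v` is the coefficient `u_n v` in
`Y⁺(u,z) v = ∑ₙ (u_n v) z^(-n-1)`. The laws are in `IsConformalSuperalgebra`. -/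
structure ConformalData (F R : Type*) [Field F] [AddCommGroup R] [Module F R] where
  grade : ZMod 2 → Submodule F R
  D : R →ₗ[F] R
  Y : ℕ → R →ₗ[F] R →ₗ[F] R

section General

variable {F R : Type*} [Field F] [AddCommGroup R] [Module F R]

/-- The laws of a conformal superalgebra, written coefficientwise. -/
structure IsConformalSuperalgebra (C : ConformalData F R) : Prop where
  /-- `R = R₀ ⊕ R₁` -/
  internal : DirectSum.IsInternal C.grade
  D_grade : ∀ i, ∀ u ∈ C.grade i, C.D u ∈ C.grade i
  Y_grade : ∀ n i j, ∀ u ∈ C.grade i, ∀ v ∈ C.grade j, C.Y n u v ∈ C.grade (i + j)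
  /-- `Y⁺(u,z) v` is a polynomial in `z⁻¹` -/
  locality : ∀ u v, ∃ N, ∀ n, N ≤ n → C.Y n u v = 0
  /-- `Y⁺(∂u,z) = dY⁺(u,z)/dz` -/
  deriv_zero : ∀ u v, C.Y 0 (C.D u) v = 0
  deriv_succ : ∀ n u v, C.Y (n + 1) (C.D u) v = -((n + 1 : ℕ) : F) • C.Y n u v
  /-- `Y⁺(u,z)v = (-1)^{ij} Res_x e^{x∂} Y⁺(v,-x)u / (z-x)` (by locality the sum is finite) -/
  skew : ∀ i j, ∀ u ∈ C.grade i, ∀ v ∈ C.grade j, ∀ n,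
    C.Y n u v = (-1 : F) ^ (i.val * j.val) •
      ∑ᶠ s : ℕ, ((-1 : F) ^ (n + s + 1) * ((s.factorial : F))⁻¹) •
        (C.D ^ s) (C.Y (n + s) v u)
  /-- `Y⁺(u,z₁)Y⁺(v,z₂) - (-1)^{ij} Y⁺(v,z₂)Y⁺(u,z₁) = Res_x Y⁺(Y⁺(u,z₁-x)v,x) / (z₂-x)` -/
  jacobi : ∀ i j, ∀ u ∈ C.grade i, ∀ v ∈ C.grade j, ∀ m n w,
    C.Y m u (C.Y n v w) - (-1 : F) ^ (i.val * j.val) • C.Y n v (C.Y m u w) =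
      ∑ s ∈ Finset.range (m + 1), (m.choose s : F) • C.Y (m + n - s) (C.Y s u v) w

/-- An ideal: a subspace `I` with `∂ I ⊆ I` and `Y⁺(u,z) I ⊆ I[z⁻¹]` for all `u ∈ R`. -/
def IsIdeal (C : ConformalData F R) (I : Submodule F R) : Prop :=
  (∀ v ∈ I, C.D v ∈ I) ∧ ∀ n u, ∀ v ∈ I, C.Y n u v ∈ I

/-- The only ideals are `{0}` and `R`. -/
def IsSimple (C : ConformalData F R) : Prop :=
  ∀ I : Submodule F R, IsIdeal C I → I = ⊥ ∨ I = ⊤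

/-- The elements `u¹_{m₁} ⋯ uᵖ_{m_p} v` with `uʲ, v ∈ S` and `p, mⱼ ∈ ℕ`. -/
def words (C : ConformalData F R) (S : Set R) : Set R :=
  {w | ∃ (L : List (ℕ × R)) (v : R), (∀ x ∈ L, x.2 ∈ S) ∧ v ∈ S ∧
    w = L.foldr (fun x y => C.Y x.1 x.2 y) v}

/-- `R` is generated by `S`: it is the span of the words in `S`. -/
def GeneratedBy (C : ConformalData F R) (S : Set R) : Prop :=
  Submodule.span F (words C S) = ⊤

end General

/-! ### The construction from a `ℤ/2`-graded associative algebra -/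

/-- `M_{2×2}(A) ⊗ F[t₁,t₂]`, in the coordinates given by the monomials `t₁^m t₂^n`. -/
abbrev M2Poly (A : Type*) [Ring A] := (ℕ × ℕ) →₀ Matrix (ZMod 2) (ZMod 2) A

/-- `u_{[i,j]}(m,n) = u_{[i,j]} ⊗ t₁^m t₂^n`. -/
noncomputable def elt {A : Type*} [Ring A] (i j : ZMod 2) (u : A) (m n : ℕ) : M2Poly A :=
  Finsupp.single (m, n) (Matrix.single i j u)

section Construction

variable (F : Type*) {A : Type*} [Field F] [Ring A] [Algebra F A]

/-- `N(A)`: the `2×2` matrices whose `(i,j)` entry lies in `A_{i+j}`. -/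
def NA (𝒜 : ZMod 2 → Submodule F A) : Submodule F (Matrix (ZMod 2) (ZMod 2) A) where
  carrier := {M | ∀ i j, M i j ∈ 𝒜 (i + j)}
  add_mem' ha hb i j := (𝒜 (i + j)).add_mem (ha i j) (hb i j)
  zero_mem' i j := (𝒜 (i + j)).zero_mem
  smul_mem' c _ ha i j := (𝒜 (i + j)).smul_mem c (ha i j)

/-- `R(A) = N(A) ⊗ F[t₁,t₂]`. -/
def RA (𝒜 : ZMod 2 → Submodule F A) : Submodule F (M2Poly A) where
  carrier := {f | ∀ m, f m ∈ NA F 𝒜}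
  add_mem' ha hb m := (NA F 𝒜).add_mem (ha m) (hb m)
  zero_mem' _ := (NA F 𝒜).zero_mem
  smul_mem' c _ ha m := (NA F 𝒜).smul_mem c (ha m)

/-- `∂ u(m,n) = (m+1) u(m+1,n) + (n+1) u(m,n+1)`. -/
noncomputable def partialD : M2Poly A →ₗ[F] M2Poly A :=
  Finsupp.lsum F fun m : ℕ × ℕ =>
    ((m.1 + 1 : ℕ) : F) • Finsupp.lsingle (m.1 + 1, m.2) +
    ((m.2 + 1 : ℕ) : F) • Finsupp.lsingle (m.1, m.2 + 1)

/-- `δ_{i,0}` -/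
def d0 (i : ZMod 2) : ℕ := if i = 0 then 1 else 0

/-- `δ_{i,1}` -/
def d1 (i : ZMod 2) : ℕ := if i = 1 then 1 else 0

/-- The binomial coefficient `(a choose m)`, `a ∈ ℤ`, as an element of `F`. -/
def binom (a : ℤ) (m : ℕ) : F := ((Ring.choose a m : ℤ) : F)

/-- The coefficient of `z^(-n-1)` in the first summand of `Y⁺(u_{[i₁,i₂]}(m₁,m₂),z)v_{[j₁,j₂]}(n₁,n₂)`,
`δ_{i₂,j₁} (n₁δ_{i₂,0}+1) (-n₁-1-δ_{i₂,0} choose m₂)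
  ∑_{p=0}^N (p choose m₁) (uv)_{[i₁,j₂]}(p,n₂) z^(p-N-1)`, where `N = m₁+m₂+n₁+δ_{i₂,0}`. -/
noncomputable def term₁ (n : ℕ) (i₁ i₂ : ZMod 2) (m₁ m₂ : ℕ) (u : A)
    (j₁ j₂ : ZMod 2) (n₁ n₂ : ℕ) (v : A) : M2Poly A :=
  if i₂ = j₁ then
    (((n₁ * d0 i₂ + 1 : ℕ) : F) * binom F (-(n₁ : ℤ) - 1 - (d0 i₂ : ℤ)) m₂) •
      ∑ p ∈ Finset.range (m₁ + m₂ + n₁ + d0 i₂ + 1),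
        if p + n = m₁ + m₂ + n₁ + d0 i₂ then
          (p.choose m₁ : F) • elt i₁ j₂ (u * v) p n₂ else 0
  else 0

/-- The coefficient of `z^(-n-1)` in the second summand of `Y⁺(u_{[i₁,i₂]}(m₁,m₂),z)v_{[j₁,j₂]}(n₁,n₂)`,
`-(-1)^((i₁+i₂)(j₁+j₂)) δ_{i₁,j₂} (δ_{i₁,1}-(n₂+1)δ_{i₁,0}) (-n₂-1-δ_{i₁,0} choose m₁)
  ∑_{q=0}^N (q choose m₂) (vu)_{[j₁,i₂]}(n₁,q) z^(q-N-1)`, where `N = m₁+m₂+n₂+δ_{i₁,0}`. -/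
noncomputable def term₂ (n : ℕ) (i₁ i₂ : ZMod 2) (m₁ m₂ : ℕ) (u : A)
    (j₁ j₂ : ZMod 2) (n₁ n₂ : ℕ) (v : A) : M2Poly A :=
  if i₁ = j₂ then
    (-(-1 : F) ^ ((i₁ + i₂) * (j₁ + j₂)).val *
        ((d1 i₁ : F) - ((n₂ + 1 : ℕ) : F) * (d0 i₁ : F)) *
        binom F (-(n₂ : ℤ) - 1 - (d0 i₁ : ℤ)) m₁) •
      ∑ q ∈ Finset.range (m₁ + m₂ + n₂ + d0 i₁ + 1),
        if q + n = m₁ + m₂ + n₂ + d0 i₁ then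
          (q.choose m₂ : F) • elt j₁ i₂ (v * u) n₁ q else 0
  else 0


/-- The bilinear map `(f, g) ↦ f_n g` on `M_{2×2}(A) ⊗ F[t₁,t₂]` with
`u_{[i₁,i₂]}(m₁,m₂)_n v_{[j₁,j₂]}(n₁,n₂) = term₁ + term₂`. -/
noncomputable def nthFun (n : ℕ) (f g : M2Poly A) : M2Poly A :=
  f.sum fun m U => g.sum fun k V => ∑ i₁, ∑ i₂, ∑ j₁, ∑ j₂,
    (term₁ F n i₁ i₂ m.1 m.2 (U i₁ i₂) j₁ j₂ k.1 k.2 (V j₁ j₂) +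
      term₂ F n i₁ i₂ m.1 m.2 (U i₁ i₂) j₁ j₂ k.1 k.2 (V j₁ j₂))

/-- The subspace of weight `α` of `R(A)`, spanned by the `u_{[i,j]}(m₁,m₂)` with
`m₁ + m₂ + δ_{i,0} + δ_{j,0} + (δ_{i,1} + δ_{j,1})/2 = α`. -/
noncomputable def weightRA (𝒜 : ZMod 2 → Submodule F A) (α : ℚ) : Submodule F (M2Poly A) :=
  Submodule.span F {x | ∃ (i j : ZMod 2) (u : A) (m₁ m₂ : ℕ), u ∈ 𝒜 (i + j) ∧
    (m₁ + m₂ + d0 i + d0 j + (d1 i + d1 j) / 2 : ℚ) = α ∧ x = elt i j u m₁ m₂}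

end Construction

section Bilinear

variable {F A : Type*} [Field F] [Ring A] [Algebra F A]

theorem elt_add (i j : ZMod 2) (u v : A) (m n : ℕ) :
    elt i j (u + v) m n = elt i j u m n + elt i j v m n := by
  simp [elt, Matrix.single_add]

theorem elt_smul (i j : ZMod 2) (c : F) (u : A) (m n : ℕ) :
    elt i j (c • u) m n = c • elt i j u m n := by
  simp [elt, Matrix.smul_single]

theorem elt_zero (i j : ZMod 2) (m n : ℕ) : elt i j (0 : A) m n = 0 := by
  simp [elt]

theorem term₁_add_left (n : ℕ) (i₁ i₂ m₁ m₂ u u' j₁ j₂ n₁ n₂) (v : A) :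
    term₁ F n i₁ i₂ m₁ m₂ (u + u') j₁ j₂ n₁ n₂ v =
      term₁ F n i₁ i₂ m₁ m₂ u j₁ j₂ n₁ n₂ v + term₁ F n i₁ i₂ m₁ m₂ u' j₁ j₂ n₁ n₂ v := by
  unfold term₁
  split_ifs
  · refine Eq.trans ?_ (smul_add _ _ _)
    rw [← Finset.sum_add_distrib]
    congr 1
    refine Finset.sum_congr rfl fun p _ => ?_
    split_ifs <;> simp [add_mul, elt_add]
  · simp

theorem term₁_add_right (n : ℕ) (i₁ i₂ m₁ m₂) (u : A) (j₁ j₂ n₁ n₂ v v') :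
    term₁ F n i₁ i₂ m₁ m₂ u j₁ j₂ n₁ n₂ (v + v') =
      term₁ F n i₁ i₂ m₁ m₂ u j₁ j₂ n₁ n₂ v + term₁ F n i₁ i₂ m₁ m₂ u j₁ j₂ n₁ n₂ v' := by
  unfold term₁
  split_ifs
  · refine Eq.trans ?_ (smul_add _ _ _)
    rw [← Finset.sum_add_distrib]
    congr 1
    refine Finset.sum_congr rfl fun p _ => ?_
    split_ifs <;> simp [mul_add, elt_add]
  · simp

theorem term₁_smul_left (n : ℕ) (i₁ i₂ m₁ m₂) (c : F) (u : A) (j₁ j₂ n₁ n₂ v) :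
    term₁ F n i₁ i₂ m₁ m₂ (c • u) j₁ j₂ n₁ n₂ v =
      c • term₁ F n i₁ i₂ m₁ m₂ u j₁ j₂ n₁ n₂ v := by
  unfold term₁
  split_ifs
  · rw [smul_comm c]
    congr 1
    rw [Finset.smul_sum]
    refine Finset.sum_congr rfl fun p _ => ?_
    split_ifs
    · rw [smul_mul_assoc, elt_smul, smul_comm]
    · simp
  · simp

theorem term₁_smul_right (n : ℕ) (i₁ i₂ m₁ m₂) (u : A) (j₁ j₂ n₁ n₂) (c : F) (v : A) :
    term₁ F n i₁ i₂ m₁ m₂ u j₁ j₂ n₁ n₂ (c • v) =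
      c • term₁ F n i₁ i₂ m₁ m₂ u j₁ j₂ n₁ n₂ v := by
  unfold term₁
  split_ifs
  · rw [smul_comm c]
    congr 1
    rw [Finset.smul_sum]
    refine Finset.sum_congr rfl fun p _ => ?_
    split_ifs
    · rw [mul_smul_comm, elt_smul, smul_comm]
    · simp
  · simp

theorem term₂_add_left (n : ℕ) (i₁ i₂ m₁ m₂ u u' j₁ j₂ n₁ n₂) (v : A) :
    term₂ F n i₁ i₂ m₁ m₂ (u + u') j₁ j₂ n₁ n₂ v =
      term₂ F n i₁ i₂ m₁ m₂ u j₁ j₂ n₁ n₂ v + term₂ F n i₁ i₂ m₁ m₂ u' j₁ j₂ n₁ n₂ v := by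
  unfold term₂
  split_ifs
  · refine Eq.trans ?_ (smul_add _ _ _)
    rw [← Finset.sum_add_distrib]
    congr 1
    refine Finset.sum_congr rfl fun p _ => ?_
    split_ifs <;> simp [mul_add, elt_add]
  · simp

theorem term₂_add_right (n : ℕ) (i₁ i₂ m₁ m₂) (u : A) (j₁ j₂ n₁ n₂ v v') :
    term₂ F n i₁ i₂ m₁ m₂ u j₁ j₂ n₁ n₂ (v + v') =
      term₂ F n i₁ i₂ m₁ m₂ u j₁ j₂ n₁ n₂ v + term₂ F n i₁ i₂ m₁ m₂ u j₁ j₂ n₁ n₂ v' := by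
  unfold term₂
  split_ifs
  · refine Eq.trans ?_ (smul_add _ _ _)
    rw [← Finset.sum_add_distrib]
    congr 1
    refine Finset.sum_congr rfl fun p _ => ?_
    split_ifs <;> simp [add_mul, elt_add]
  · simp

theorem term₂_smul_left (n : ℕ) (i₁ i₂ m₁ m₂) (c : F) (u : A) (j₁ j₂ n₁ n₂ v) :
    term₂ F n i₁ i₂ m₁ m₂ (c • u) j₁ j₂ n₁ n₂ v =
      c • term₂ F n i₁ i₂ m₁ m₂ u j₁ j₂ n₁ n₂ v := by
  unfold term₂
  split_ifs
  · rw [smul_comm c]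
    congr 1
    rw [Finset.smul_sum]
    refine Finset.sum_congr rfl fun p _ => ?_
    split_ifs
    · rw [mul_smul_comm, elt_smul, smul_comm]
    · simp
  · simp

theorem term₂_smul_right (n : ℕ) (i₁ i₂ m₁ m₂) (u : A) (j₁ j₂ n₁ n₂) (c : F) (v : A) :
    term₂ F n i₁ i₂ m₁ m₂ u j₁ j₂ n₁ n₂ (c • v) =
      c • term₂ F n i₁ i₂ m₁ m₂ u j₁ j₂ n₁ n₂ v := by
  unfold term₂
  split_ifs
  · rw [smul_comm c]
    congr 1
    rw [Finset.smul_sum]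
    refine Finset.sum_congr rfl fun p _ => ?_
    split_ifs
    · rw [smul_mul_assoc, elt_smul, smul_comm]
    · simp
  · simp

theorem term₁_zero_left (n : ℕ) (i₁ i₂ m₁ m₂ j₁ j₂ n₁ n₂) (v : A) :
    term₁ F n i₁ i₂ m₁ m₂ 0 j₁ j₂ n₁ n₂ v = 0 := by
  simpa using term₁_smul_left n i₁ i₂ m₁ m₂ (0 : F) 0 j₁ j₂ n₁ n₂ v

theorem term₁_zero_right (n : ℕ) (i₁ i₂ m₁ m₂) (u : A) (j₁ j₂ n₁ n₂) :
    term₁ F n i₁ i₂ m₁ m₂ u j₁ j₂ n₁ n₂ 0 = 0 := by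
  simpa using term₁_smul_right n i₁ i₂ m₁ m₂ u j₁ j₂ n₁ n₂ (0 : F) 0

theorem term₂_zero_left (n : ℕ) (i₁ i₂ m₁ m₂ j₁ j₂ n₁ n₂) (v : A) :
    term₂ F n i₁ i₂ m₁ m₂ 0 j₁ j₂ n₁ n₂ v = 0 := by
  simpa using term₂_smul_left n i₁ i₂ m₁ m₂ (0 : F) 0 j₁ j₂ n₁ n₂ v

theorem term₂_zero_right (n : ℕ) (i₁ i₂ m₁ m₂) (u : A) (j₁ j₂ n₁ n₂) :
    term₂ F n i₁ i₂ m₁ m₂ u j₁ j₂ n₁ n₂ 0 = 0 := by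
  simpa using term₂_smul_right n i₁ i₂ m₁ m₂ u j₁ j₂ n₁ n₂ (0 : F) 0

theorem nthFun_add_left (n : ℕ) (f f' g : M2Poly A) :
    nthFun F n (f + f') g = nthFun F n f g + nthFun F n f' g := by
  unfold nthFun
  refine Finsupp.sum_add_index' (fun m => ?_) (fun m U U' => ?_)
  · simp [term₁_zero_left, term₂_zero_left]
  · rw [← Finsupp.sum_add]
    refine Finsupp.sum_congr fun k _ => ?_
    simp only [← Finset.sum_add_distrib, Matrix.add_apply, term₁_add_left, term₂_add_left]
    refine Finset.sum_congr rfl fun _ _ => Finset.sum_congr rfl fun _ _ =>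
      Finset.sum_congr rfl fun _ _ => Finset.sum_congr rfl fun _ _ => ?_
    abel

theorem nthFun_add_right (n : ℕ) (f g g' : M2Poly A) :
    nthFun F n f (g + g') = nthFun F n f g + nthFun F n f g' := by
  unfold nthFun
  rw [← Finsupp.sum_add]
  refine Finsupp.sum_congr fun m _ => ?_
  refine Finsupp.sum_add_index' (fun k => ?_) (fun k V V' => ?_)
  · simp [term₁_zero_right, term₂_zero_right]
  · simp only [← Finset.sum_add_distrib, Matrix.add_apply, term₁_add_right, term₂_add_right]
    refine Finset.sum_congr rfl fun _ _ => Finset.sum_congr rfl fun _ _ =>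
      Finset.sum_congr rfl fun _ _ => Finset.sum_congr rfl fun _ _ => ?_
    abel

theorem nthFun_smul_left (n : ℕ) (c : F) (f g : M2Poly A) :
    nthFun F n (c • f) g = c • nthFun F n f g := by
  unfold nthFun
  rw [Finsupp.sum_smul_index' (fun m => by simp [term₁_zero_left, term₂_zero_left]),
    Finsupp.smul_sum]
  refine Finsupp.sum_congr fun m _ => ?_
  rw [Finsupp.smul_sum]
  refine Finsupp.sum_congr fun k _ => ?_
  simp only [Finset.smul_sum, Matrix.smul_apply, term₁_smul_left, term₂_smul_left, smul_add]

theorem nthFun_smul_right (n : ℕ) (c : F) (f g : M2Poly A) :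
    nthFun F n f (c • g) = c • nthFun F n f g := by
  unfold nthFun
  rw [Finsupp.smul_sum]
  refine Finsupp.sum_congr fun m _ => ?_
  rw [Finsupp.sum_smul_index' (fun m => by simp [term₁_zero_right, term₂_zero_right]),
    Finsupp.smul_sum]
  refine Finsupp.sum_congr fun k _ => ?_
  simp only [Finset.smul_sum, Matrix.smul_apply, term₁_smul_right, term₂_smul_right, smul_add]

/-- On monomials, `nthFun` is the defining formula. -/
theorem nthFun_elt (n : ℕ) (i₁ i₂ : ZMod 2) (u : A) (m₁ m₂ : ℕ) (j₁ j₂ : ZMod 2) (v : A)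
    (n₁ n₂ : ℕ) :
    nthFun F n (elt i₁ i₂ u m₁ m₂) (elt j₁ j₂ v n₁ n₂) =
      term₁ F n i₁ i₂ m₁ m₂ u j₁ j₂ n₁ n₂ v + term₂ F n i₁ i₂ m₁ m₂ u j₁ j₂ n₁ n₂ v := by
  unfold nthFun
  rw [elt, elt, Finsupp.sum_single_index, Finsupp.sum_single_index]
  · rw [Fintype.sum_eq_single i₁, Fintype.sum_eq_single i₂, Fintype.sum_eq_single j₁,
      Fintype.sum_eq_single j₂]
    · simp
    all_goals
      intro x hx
      simp [Matrix.single_apply, hx.symm, term₁_zero_left, term₂_zero_left, term₁_zero_right,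
        term₂_zero_right]
  · simp [term₁_zero_right, term₂_zero_right]
  · simp [term₁_zero_left, term₂_zero_left]

end Bilinear

/-- `nthFun` as a bilinear map. -/
noncomputable def nthProd (F : Type*) {A : Type*} [Field F] [Ring A] [Algebra F A] (n : ℕ) :
    M2Poly A →ₗ[F] M2Poly A →ₗ[F] M2Poly A :=
  LinearMap.mk₂ F (nthFun F n) (nthFun_add_left n) (nthFun_smul_left n) (nthFun_add_right n)
    (nthFun_smul_right n)

/-! ### The superalgebra `R_{[k₁,k₂],ℓ+1}` -/

/-- `M_{k×k}(F)`, `k = k₁ + k₂`. The indices `1,…,k₁` are the `Sum.inl p₁`, the indices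
`k₁+1,…,k₁+k₂` are the `Sum.inr p₂`. -/
abbrev Mat (F : Type*) (k₁ k₂ : ℕ) := Matrix (Fin k₁ ⊕ Fin k₂) (Fin k₁ ⊕ Fin k₂) F

section MatrixCase

variable (F : Type*) [Field F] {k₁ k₂ : ℕ}

/-- The block of an index: `0` for `1,…,k₁` and `1` for `k₁+1,…,k₁+k₂`. -/
def blk : Fin k₁ ⊕ Fin k₂ → ZMod 2 := Sum.elim (fun _ => 0) (fun _ => 1)

/-- The grading of `M_{k×k}(F)`: degree `0` is block diagonal, degree `1` is block off-diagonal. -/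
def blockGrading (k₁ k₂ : ℕ) (i : ZMod 2) : Submodule F (Mat F k₁ k₂) where
  carrier := {M | ∀ p q, blk p + blk q ≠ i → M p q = 0}
  add_mem' ha hb p q h := by simp [ha p q h, hb p q h]
  zero_mem' _ _ _ := rfl
  smul_mem' c _ ha p q h := by simp [ha p q h]

theorem mem_blockGrading_zero (M : Mat F k₁ k₂) :
    M ∈ blockGrading F k₁ k₂ 0 ↔ ∃ A B, M = Matrix.fromBlocks A 0 0 B := by
  constructor
  · intro h
    refine ⟨M.toBlocks₁₁, M.toBlocks₂₂, ?_⟩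
    ext (p | p) (q | q)
    · rfl
    · exact h _ _ (by simp [blk])
    · exact h _ _ (by simp [blk])
    · rfl
  · rintro ⟨A, B, rfl⟩ (p | p) (q | q) h
    · simp [blk] at h
    · rfl
    · rfl
    · exact absurd (by simp only [blk, Sum.elim_inr]; decide) h

theorem mem_blockGrading_one (M : Mat F k₁ k₂) :
    M ∈ blockGrading F k₁ k₂ 1 ↔ ∃ A B, M = Matrix.fromBlocks 0 A B 0 := by
  constructor
  · intro h
    refine ⟨M.toBlocks₁₂, M.toBlocks₂₁, ?_⟩
    ext (p | p) (q | q)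
    · exact h _ _ (by simp [blk])
    · rfl
    · rfl
    · exact h _ _ (by simp only [blk, Sum.elim_inr]; decide)
  · rintro ⟨A, B, rfl⟩ (p | p) (q | q) h
    · rfl
    · simp [blk] at h
    · simp [blk] at h
    · rfl

/-- The matrix unit `E_{p,q}`. -/
def E (p q : Fin k₁ ⊕ Fin k₂) : Mat F k₁ k₂ := Matrix.single p q 1

open Sum in
/-- The even part `(R_{[k₁,k₂],ℓ+1})₀` and the odd part `(R_{[k₁,k₂],ℓ+1})₁`. -/
noncomputable def RkPart (k₁ k₂ ℓ : ℕ) (i : ZMod 2) : Submodule F (M2Poly (Mat F k₁ k₂)) :=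
  if i = 0 then
    Submodule.span F
      ({x | ∃ (p q : Fin k₁) (m n : ℕ), x = elt 0 0 (E F (inl p) (inl q)) m (n + ℓ)} ∪
       {x | ∃ (p q : Fin k₂) (m n : ℕ), x = elt 1 1 (E F (inr p) (inr q)) m (ℓ + n)})
  else
    Submodule.span F
      ({x | ∃ (p : Fin k₁) (q : Fin k₂) (m n : ℕ), x = elt 0 1 (E F (inl p) (inr q)) m (ℓ + n)} ∪
       {x | ∃ (p : Fin k₁) (q : Fin k₂) (m n : ℕ), x = elt 1 0 (E F (inr q) (inl p)) m (ℓ + n)})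

/-- The space `R_{[k₁,k₂],ℓ+1}`. -/
noncomputable def Rk (k₁ k₂ ℓ : ℕ) : Submodule F (M2Poly (Mat F k₁ k₂)) :=
  RkPart F k₁ k₂ ℓ 0 ⊔ RkPart F k₁ k₂ ℓ 1

theorem elt_mem_Rk {ℓ : ℕ} (p q : Fin k₁ ⊕ Fin k₂) (m n : ℕ) (h : ℓ ≤ n) :
    elt (blk p) (blk q) (E F p q) m n ∈ Rk F k₁ k₂ ℓ := by
  obtain ⟨n, rfl⟩ := Nat.exists_eq_add_of_le h
  rcases p with p | p <;> rcases q with q | q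
  · refine Submodule.mem_sup_left ?_
    rw [RkPart, if_pos rfl]
    exact Submodule.subset_span (Or.inl ⟨p, q, m, n, by rw [add_comm n]; rfl⟩)
  · refine Submodule.mem_sup_right ?_
    rw [RkPart, if_neg one_ne_zero]
    exact Submodule.subset_span (Or.inl ⟨p, q, m, n, rfl⟩)
  · refine Submodule.mem_sup_right ?_
    rw [RkPart, if_neg one_ne_zero]
    exact Submodule.subset_span (Or.inr ⟨q, p, m, n, rfl⟩)
  · refine Submodule.mem_sup_left ?_
    rw [RkPart, if_pos rfl]
    exact Submodule.subset_span (Or.inr ⟨p, q, m, n, rfl⟩)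

theorem Rk_le {ℓ : ℕ} {T : Submodule F (M2Poly (Mat F k₁ k₂))}
    (h : ∀ (p q : Fin k₁ ⊕ Fin k₂) (m n : ℕ), ℓ ≤ n → elt (blk p) (blk q) (E F p q) m n ∈ T) :
    Rk F k₁ k₂ ℓ ≤ T := by
  rw [Rk, RkPart, RkPart, if_pos rfl, if_neg one_ne_zero]
  refine sup_le (Submodule.span_le.2 ?_) (Submodule.span_le.2 ?_)
  · rintro _ (⟨p, q, m, n, rfl⟩ | ⟨p, q, m, n, rfl⟩)
    · exact h (Sum.inl p) (Sum.inl q) m (n + ℓ) (Nat.le_add_left _ _)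
    · exact h (Sum.inr p) (Sum.inr q) m (ℓ + n) (Nat.le_add_right _ _)
  · rintro _ (⟨p, q, m, n, rfl⟩ | ⟨p, q, m, n, rfl⟩)
    · exact h (Sum.inl p) (Sum.inr q) m (ℓ + n) (Nat.le_add_right _ _)
    · exact h (Sum.inr q) (Sum.inl p) m (ℓ + n) (Nat.le_add_right _ _)

/-- `R_{[k₁,k₂],ℓ+1} ⊆ R(A)`. -/
theorem Rk_le_RA (k₁ k₂ ℓ : ℕ) : Rk F k₁ k₂ ℓ ≤ RA F (blockGrading F k₁ k₂) := by
  refine Rk_le F fun p q m n _ k i j r s h => ?_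
  by_cases hk : (m, n) = k
  · subst hk
    by_cases hij : blk p = i ∧ blk q = j
    · obtain ⟨rfl, rfl⟩ := hij
      by_cases hrs : p = r ∧ q = s
      · obtain ⟨rfl, rfl⟩ := hrs
        exact absurd rfl h
      · simp [elt, E, hrs]
    · simp [elt, hij]
  · simp [elt, hk]

theorem partialD_mem_Rk (k₁ k₂ ℓ : ℕ) :
    ∀ f ∈ Rk F k₁ k₂ ℓ, partialD F f ∈ Rk F k₁ k₂ ℓ := by
  refine Rk_le F (T := (Rk F k₁ k₂ ℓ).comap (partialD F)) fun p q m n h => ?_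
  rw [Submodule.mem_comap, partialD, elt, Finsupp.lsum_single]
  exact add_mem (Submodule.smul_mem _ _ (elt_mem_Rk F p q (m + 1) n h))
    (Submodule.smul_mem _ _ (elt_mem_Rk F p q m (n + 1) (Nat.le_succ_of_le h)))

theorem term₁_mem_Rk {ℓ : ℕ} (N : ℕ) (p q r s : Fin k₁ ⊕ Fin k₂) (m₁ m₂ n₁ n₂ : ℕ)
    (h' : ℓ ≤ n₂) :
    term₁ F N (blk p) (blk q) m₁ m₂ (E F p q) (blk r) (blk s) n₁ n₂ (E F r s) ∈
      Rk F k₁ k₂ ℓ := by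
  unfold term₁
  split_ifs
  · refine Submodule.smul_mem _ _ (Submodule.sum_mem _ fun a _ => ?_)
    split_ifs
    · refine Submodule.smul_mem _ _ ?_
      by_cases hq : q = r
      · subst hq
        have := elt_mem_Rk F p s a n₂ h'
        simpa [E] using this
      · rw [E, E, Matrix.single_mul_single_of_ne _ _ _ _ hq, elt_zero]
        exact zero_mem _
    · exact zero_mem _
  · exact zero_mem _

theorem term₂_mem_Rk {ℓ : ℕ} (N : ℕ) (p q r s : Fin k₁ ⊕ Fin k₂) (m₁ m₂ n₁ n₂ : ℕ)
    (h : ℓ ≤ m₂) :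
    term₂ F N (blk p) (blk q) m₁ m₂ (E F p q) (blk r) (blk s) n₁ n₂ (E F r s) ∈
      Rk F k₁ k₂ ℓ := by
  unfold term₂
  split_ifs
  · refine Submodule.smul_mem _ _ (Submodule.sum_mem _ fun a _ => ?_)
    split_ifs
    · by_cases ha : a < m₂
      · rw [Nat.choose_eq_zero_of_lt ha, Nat.cast_zero, zero_smul]
        exact zero_mem _
      refine Submodule.smul_mem _ _ ?_
      by_cases hq : s = p
      · subst hq
        have := elt_mem_Rk F r q n₁ a (h.trans (not_lt.1 ha))
        simpa [E] using this
      · rw [E, E, Matrix.single_mul_single_of_ne _ _ _ _ hq, elt_zero]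
        exact zero_mem _
    · exact zero_mem _
  · exact zero_mem _

theorem nthProd_elt_mem_Rk {ℓ : ℕ} (n : ℕ) (p q : Fin k₁ ⊕ Fin k₂) (m₁ m₂ : ℕ) (h : ℓ ≤ m₂) :
    ∀ g ∈ Rk F k₁ k₂ ℓ,
      nthProd F n (elt (blk p) (blk q) (E F p q) m₁ m₂) g ∈ Rk F k₁ k₂ ℓ := by
  refine Rk_le F (T := (Rk F k₁ k₂ ℓ).comap (nthProd F n (elt (blk p) (blk q) (E F p q) m₁ m₂)))
    fun r s n₁ n₂ h' => ?_
  rw [Submodule.mem_comap, nthProd, LinearMap.mk₂_apply, nthFun_elt]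
  exact add_mem (term₁_mem_Rk F n p q r s m₁ m₂ n₁ n₂ h')
    (term₂_mem_Rk F n p q r s m₁ m₂ n₁ n₂ h)

theorem nthProd_mem_Rk (k₁ k₂ ℓ n : ℕ) (f : M2Poly (Mat F k₁ k₂)) (hf : f ∈ Rk F k₁ k₂ ℓ)
    (g : M2Poly (Mat F k₁ k₂)) (hg : g ∈ Rk F k₁ k₂ ℓ) :
    nthProd F n f g ∈ Rk F k₁ k₂ ℓ := by
  have key : Rk F k₁ k₂ ℓ ≤ (Rk F k₁ k₂ ℓ).comap ((nthProd F n).flip g) := by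
    refine Rk_le F fun p q m₁ m₂ h => ?_
    rw [Submodule.mem_comap, LinearMap.flip_apply]
    exact nthProd_elt_mem_Rk F n p q m₁ m₂ h g hg
  have h := key hf
  rwa [Submodule.mem_comap, LinearMap.flip_apply] at h

/-- `(R_{[k₁,k₂],ℓ+1}, ∂, Y⁺(·,z))`, with the operations restricted from `R(A)`. -/
noncomputable def RkAlg (k₁ k₂ ℓ : ℕ) : ConformalData F (Rk F k₁ k₂ ℓ) where
  grade i := (RkPart F k₁ k₂ ℓ i).submoduleOf (Rk F k₁ k₂ ℓ)
  D := (partialD F).restrict (partialD_mem_Rk F k₁ k₂ ℓ)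
  Y n := LinearMap.mk₂ F
    (fun f g => ⟨nthProd F n f.1 g.1, nthProd_mem_Rk F k₁ k₂ ℓ n f.1 f.2 g.1 g.2⟩)
    (fun _ _ _ => Subtype.ext (by simp)) (fun _ _ _ => Subtype.ext (by simp))
    (fun _ _ _ => Subtype.ext (by simp)) (fun _ _ _ => Subtype.ext (by simp))

/-- The element `(E_{p,q})_{[i,j]}(m,n)` of `R_{[k₁,k₂],ℓ+1}`, where `n ≥ ℓ`, and `i` and `j` are
the blocks of `p` and `q`. -/
noncomputable def RkElt {ℓ : ℕ} (p q : Fin k₁ ⊕ Fin k₂) (m n : ℕ) (h : ℓ ≤ n) : Rk F k₁ k₂ ℓ :=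
  ⟨elt (blk p) (blk q) (E F p q) m n, elt_mem_Rk F p q m n h⟩

/-- The subspace of weight `α` of `R_{[k₁,k₂],ℓ+1}`. -/
noncomputable def RkWeight (k₁ k₂ ℓ : ℕ) (α : ℚ) : Submodule F (Rk F k₁ k₂ ℓ) :=
  (weightRA F (blockGrading F k₁ k₂) α).submoduleOf (Rk F k₁ k₂ ℓ)

end MatrixCase

end ConfSuper

open ConfSuper

namespace ConfSuper

/-! The products become transparent after a Borel transform. Replace t₁^m t₂^n by x^m y^n/(m! n!),
so that an element f turns into a matrix-valued polynomial f(x,y) (`Ev`), and collect the products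
into ∑ l^n/n! f_n g. In characteristic 0 the binomial coefficients of the definition are absorbed by
the divided powers. With C(t) the diagonal matrix `contr`, which is t on the first block and 1 on
the second, the generating function of the products of homogeneous f, g is (`sum_dpow_nthProd`) [f_l
g](x,y) = f(x,-x-l) C(x+l) g(x+l,y) ∓ g(x,y+l) C(-y-l) f(-y-l,y), a supercommutator for an
associative composition of kernels, and ∂ is multiplication by x+y (`Ev_partialD`).

All laws can now be read off. Replacing f by ∂f multiplies both terms by -l. The substitution l ↦
-x-y-l together with swapping f and g exchanges the two terms, which is skew-symmetry. The Jacobi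
identity for the brackets with parameters l, u and l+u is the usual consequence of associativity of
matrix multiplication. Nothing is lost on the way: a polynomial vanishing on an infinite field is
zero, so identities between values give identities between coefficients
(`eq_zero_of_sum_dpow_eq_zero`, `eq_zero_of_Ev`).

Simplicity and generation use leading terms instead. On basis elements the product is a left
multiplication term plus a right multiplication term, and each is annihilated either by a mismatch
of matrix units or by a large enough order n (`nthProd_mono_left`, `nthProd_mono_right`). For a
nonzero f in an ideal, one left multiplication isolates the top t₁-degree in one row and one right
multiplication the top t₂-degree in one column. What remains is a nonzero multiple of an arbitrary
basis element (`exists_nthProd_nthProd_eq_mono`).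

For generation, the elements of the span J of all words whose products preserve J are closed under
products, by the Jacobi identity (`Stab.nthProd`). It therefore suffices to reach each basis element
by successive products. The essential point is to raise the t₂-degree above ℓ, for which one needs
elements E_{r,q} of the second diagonal block with t₂-degree ℓ+1. For k > 2 there is room to make
them out of the odd generators (`exists_stab_mono_succ`); for k = 2 such an element is among the
generators. -/

theorem sum_triangle {V : Type*} [AddCommMonoid V] (c : ℕ → ℕ → V) {K N₁ N₂ : ℕ} (h₁ : K ≤ N₁) (h₂ : K ≤ N₂)
    (hc : ∀ i n, K ≤ i + n → c i n = 0) :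
    ∑ i ∈ Finset.range N₁, ∑ n ∈ Finset.range N₂, c i n =
      ∑ t ∈ Finset.range K, ∑ i ∈ Finset.range (t + 1), c i (t - i) := by
  rw [Finset.sum_range_diag_flip,
    ← Finset.sum_subset (Finset.range_subset_range.2 h₁) fun i _ hi => ?_]
  · refine Finset.sum_congr rfl fun i _ => ?_
    refine (Finset.sum_subset (Finset.range_subset_range.2 (by omega)) fun n _ hn => ?_).symm
    exact hc _ _ (by rw [Finset.mem_range] at hn; omega)
  · refine Finset.sum_eq_zero fun n _ => hc _ _ ?_
    rw [Finset.mem_range] at hi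
    omega

/-! ### Divided powers and generating functions. -/

section DividedPowers

variable {F : Type*} [Field F]

/-- The divided power `aⁿ / n!`. -/
noncomputable def dpow (a : F) (n : ℕ) : F := a ^ n * (n.factorial : F)⁻¹

theorem dpow_neg (a : F) (n : ℕ) : dpow (-a) n = (-1) ^ n * dpow a n := by
  unfold dpow
  rw [neg_pow, mul_assoc]

theorem binom_neg_sub_one (a : ℕ) (m : ℕ) :
    binom F (-(a : ℤ) - 1) m = (-1) ^ m * ((m + a).choose m : F) := by
  unfold binom
  rw [show -(a : ℤ) - 1 = -((a + 1 : ℕ) : ℤ) by push_cast; ring, Ring.choose_neg,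
    show (((a + 1 : ℕ) : ℤ) + m - 1) = ((m + a : ℕ) : ℤ) by push_cast; ring,
    Ring.choose_natCast, Int.negOnePow_def]
  simp [Units.smul_def]

variable [CharZero F]

theorem succ_mul_dpow_succ (a : F) (n : ℕ) :
    ((n + 1 : ℕ) : F) * dpow a (n + 1) = a * dpow a n := by
  have h : (n.factorial : F) ≠ 0 := Nat.cast_ne_zero.2 n.factorial_ne_zero
  have h' : ((n + 1 : ℕ) : F) ≠ 0 := Nat.cast_ne_zero.2 n.succ_ne_zero
  unfold dpow
  rw [Nat.factorial_succ, Nat.cast_mul]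
  field_simp
  ring

theorem choose_mul_dpow_add (a : F) (m n : ℕ) :
    ((m + n).choose m : F) * dpow a (m + n) = dpow a m * dpow a n := by
  have h1 : (m.factorial : F) ≠ 0 := Nat.cast_ne_zero.2 m.factorial_ne_zero
  have h2 : (n.factorial : F) ≠ 0 := Nat.cast_ne_zero.2 n.factorial_ne_zero
  have h3 : ((m + n).factorial : F) ≠ 0 := Nat.cast_ne_zero.2 (m + n).factorial_ne_zero
  have h := congrArg (Nat.cast (R := F)) (Nat.add_choose_mul_factorial_mul_factorial m n)
  rw [← Nat.choose_symm_add] at h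
  push_cast at h
  unfold dpow
  field_simp
  rw [← h, pow_add]
  ring

theorem sum_dpow_mul_dpow (a b : F) (n : ℕ) :
    ∑ k ∈ Finset.range (n + 1), dpow a k * dpow b (n - k) = dpow (a + b) n := by
  have h : (n.factorial : F) ≠ 0 := Nat.cast_ne_zero.2 n.factorial_ne_zero
  rw [dpow, add_pow, Finset.sum_mul]
  refine Finset.sum_congr rfl fun k hk => ?_
  obtain ⟨j, rfl⟩ := Nat.exists_eq_add_of_le (Nat.lt_succ_iff.1 (Finset.mem_range.1 hk))
  have h1 : (k.factorial : F) ≠ 0 := Nat.cast_ne_zero.2 k.factorial_ne_zero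
  have h2 : (j.factorial : F) ≠ 0 := Nat.cast_ne_zero.2 j.factorial_ne_zero
  have h' := congrArg (Nat.cast (R := F)) (Nat.add_choose_mul_factorial_mul_factorial k j)
  rw [← Nat.choose_symm_add] at h'
  push_cast at h'
  unfold dpow
  rw [Nat.add_sub_cancel_left]
  field_simp
  rw [← h']
  ring

theorem choose_mul_dpow_sub (a : F) {m s : ℕ} (h : s ≤ m) :
    dpow a m * (m.choose s : F) = dpow a s * dpow a (m - s) := by
  obtain ⟨j, rfl⟩ := Nat.exists_eq_add_of_le h
  rw [mul_comm, choose_mul_dpow_add, Nat.add_sub_cancel_left]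

/-- The Borel transform of the contraction `1/(z+b-c)`, respectively `1/(z+b-c)²`. -/
theorem contraction_mul_dpow {δ : ℕ} (hδ : δ = 0 ∨ δ = 1) (n m : ℕ) (z : F) :
    ((n * δ + 1 : ℕ) : F) * binom F (-(n : ℤ) - 1 - (δ : ℤ)) m * dpow z (m + n + δ) =
      dpow (-z) m * (z ^ δ * dpow z n) := by
  rcases hδ with rfl | rfl
  · have := choose_mul_dpow_add z m n
    simp only [Nat.cast_zero, sub_zero, binom_neg_sub_one, dpow_neg]
    simp only [mul_zero, zero_add, Nat.cast_one, one_mul, add_zero, pow_zero]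
    rw [mul_assoc, this, mul_assoc]
  · have h1 := choose_mul_dpow_add z m (n + 1)
    have h2 := succ_mul_dpow_succ z n
    rw [show -(n : ℤ) - 1 - ((1 : ℕ) : ℤ) = -((n + 1 : ℕ) : ℤ) - 1 by push_cast; ring,
      binom_neg_sub_one, dpow_neg, mul_one, pow_one, ← h2, add_assoc]
    linear_combination ((n + 1 : ℕ) : F) * (-1) ^ m * h1

/-- Writing p = m + (M - n), the product of the binomial coefficient and x^p/p! splits as x^m/m! ·
x^(M-n)/(M-n)!, and the sum over n is the binomial theorem for (x+l)^M/M!. This is what moves the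
argument of the contracted variable from x to x+l. -/
theorem sum_dpow_expand (x l : F) (m M N : ℕ) (hN : m + M < N) :
    ∑ n ∈ Finset.range N, dpow l n * ∑ p ∈ Finset.range (m + M + 1),
      (if p + n = m + M then (p.choose m : F) * dpow x p else 0) =
      dpow x m * dpow (x + l) M := by
  have inner : ∀ n ∈ Finset.range N, (dpow l n * ∑ p ∈ Finset.range (m + M + 1),
      if p + n = m + M then (p.choose m : F) * dpow x p else 0) =
      if n ∈ Finset.range (M + 1) then dpow x m * (dpow l n * dpow x (M - n)) else 0 := by
    intro n _
    by_cases hn : n ≤ M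
    · obtain ⟨j, rfl⟩ := Nat.exists_eq_add_of_le hn
      rw [if_pos (Finset.mem_range.2 (Nat.lt_succ_of_le hn)), Finset.sum_eq_single (m + j),
        if_pos (by ring), choose_mul_dpow_add, Nat.add_sub_cancel_left]
      · ring
      · intro b _ hb
        exact if_neg (by omega)
      · intro h
        exact absurd (Finset.mem_range.2 (by omega)) h
    · rw [if_neg (fun h => hn (Nat.lt_succ_iff.1 (Finset.mem_range.1 h))), Finset.sum_eq_zero,
        mul_zero]
      intro p _
      split_ifs with h
      · rw [Nat.choose_eq_zero_of_lt (by omega), Nat.cast_zero, zero_mul]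
      · rfl
  rw [Finset.sum_congr rfl inner, ← Finset.sum_filter, Finset.filter_mem_eq_inter,
    Finset.inter_eq_right.2 (Finset.range_subset_range.2 (by omega)), ← Finset.mul_sum,
    sum_dpow_mul_dpow, add_comm x]

variable {V : Type*} [AddCommGroup V] [Module F V]

theorem sum_dpow_expand_smul (x l c d : F) (m M N : ℕ) (hN : m + M < N) (W : V) :
    ∑ n ∈ Finset.range N, dpow l n • (c • ∑ a ∈ Finset.range (m + M + 1),
      (if a + n = m + M then (a.choose m : F) • ((dpow x a * d) • W) else 0)) =
      (c * d * (dpow x m * dpow (x + l) M)) • W := by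
  rw [← sum_dpow_expand x l m M N hN, Finset.mul_sum, Finset.sum_smul]
  refine Finset.sum_congr rfl fun n _ => ?_
  rw [Finset.mul_sum, Finset.mul_sum, Finset.sum_smul, Finset.smul_sum, Finset.smul_sum]
  refine Finset.sum_congr rfl fun a _ => ?_
  split_ifs
  · rw [smul_smul, smul_smul, smul_smul]
    congr 1
    ring
  · simp

/-- The law e^a e^b = e^(a+b), applied to a finite sequence of coefficients. It produces the
parameter -l-∂ in skew-symmetry and l+u in the Jacobi identity. -/
theorem sum_dpow_add (a b : F) (c : ℕ → V) {K N₁ N₂ : ℕ} (h₁ : K ≤ N₁) (h₂ : K ≤ N₂)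
    (hc : ∀ t, K ≤ t → c t = 0) :
    ∑ i ∈ Finset.range N₁, ∑ n ∈ Finset.range N₂, (dpow a i * dpow b n) • c (i + n) =
      ∑ t ∈ Finset.range K, dpow (a + b) t • c t := by
  rw [sum_triangle _ h₁ h₂ fun i n h => by rw [hc _ h, smul_zero]]
  refine Finset.sum_congr rfl fun t _ => ?_
  rw [← sum_dpow_mul_dpow, Finset.sum_smul]
  refine Finset.sum_congr rfl fun i hi => ?_
  rw [Nat.add_sub_cancel' (Nat.lt_succ_iff.1 (Finset.mem_range.1 hi))]

/-- Linear functionals reduce this to scalar polynomials, which are determined by their values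
because a field of characteristic 0 is infinite. -/
theorem eq_zero_of_sum_dpow_eq_zero {N : ℕ} {c : ℕ → V}
    (h : ∀ a : F, ∑ n ∈ Finset.range N, dpow a n • c n = 0) : ∀ n < N, c n = 0 := by
  intro n hn
  refine (Module.forall_dual_apply_eq_zero_iff F (c n)).1 fun θ => ?_
  have hp : ∑ k ∈ Finset.range N,
      Polynomial.C ((k.factorial : F)⁻¹ * θ (c k)) * Polynomial.X ^ k = 0 := by
    refine Polynomial.funext fun a => ?_
    have := congrArg θ (h a)
    rw [map_sum, map_zero] at this
    rw [Polynomial.eval_finsetSum, Polynomial.eval_zero, ← this]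
    refine Finset.sum_congr rfl fun k _ => ?_
    simp [dpow]
    ring
  have := congrArg (fun p => Polynomial.coeff p n) hp
  simp only [Polynomial.finsetSum_coeff, Polynomial.coeff_C_mul_X_pow, Polynomial.coeff_zero,
    Finset.sum_ite_eq, Finset.mem_range, hn, if_true] at this
  exact (mul_eq_zero.1 this).resolve_left (inv_ne_zero (Nat.cast_ne_zero.2 n.factorial_ne_zero))

end DividedPowers

/-! ### Evaluation of elements as matrix-valued polynomials. -/

section Evaluation

variable {F : Type*} [Field F] {k₁ k₂ : ℕ}

variable (F) in
/-- The basis element `(E_{p,q})_{[i,j]}(m,n)`, with `i` and `j` the blocks of `p` and `q`. -/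
noncomputable def mono (p q : Fin k₁ ⊕ Fin k₂) (m n : ℕ) : M2Poly (Mat F k₁ k₂) :=
  elt (blk p) (blk q) (E F p q) m n

theorem mono_mem_Rk {ℓ : ℕ} (p q : Fin k₁ ⊕ Fin k₂) (m n : ℕ) (h : ℓ ≤ n) :
    mono F p q m n ∈ Rk F k₁ k₂ ℓ := elt_mem_Rk F p q m n h

theorem mono_mem_RkPart {ℓ : ℕ} (p q : Fin k₁ ⊕ Fin k₂) (m n : ℕ) (h : ℓ ≤ n) :
    mono F p q m n ∈ RkPart F k₁ k₂ ℓ (blk p + blk q) := by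
  obtain ⟨n, rfl⟩ := Nat.exists_eq_add_of_le h
  rcases p with p | p <;> rcases q with q | q
  · rw [RkPart, if_pos (by simp [blk])]
    exact Submodule.subset_span (Or.inl ⟨p, q, m, n, by rw [add_comm n]; rfl⟩)
  · rw [RkPart, if_neg (by simp [blk])]
    exact Submodule.subset_span (Or.inl ⟨p, q, m, n, rfl⟩)
  · rw [RkPart, if_neg (by simp [blk])]
    exact Submodule.subset_span (Or.inr ⟨q, p, m, n, rfl⟩)
  · rw [RkPart, if_pos (by simp only [blk, Sum.elim_inr]; decide)]
    exact Submodule.subset_span (Or.inr ⟨p, q, m, n, rfl⟩)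

theorem RkPart_le {ℓ : ℕ} {i : ZMod 2} {T : Submodule F (M2Poly (Mat F k₁ k₂))}
    (h : ∀ (p q : Fin k₁ ⊕ Fin k₂) (m n : ℕ), blk p + blk q = i → ℓ ≤ n → mono F p q m n ∈ T) :
    RkPart F k₁ k₂ ℓ i ≤ T := by
  have hi : ∀ i : ZMod 2, i = 0 ∨ i = 1 := by decide
  rcases hi i with rfl | rfl
  · rw [RkPart, if_pos rfl, Submodule.span_le]
    rintro _ (⟨p, q, m, n, rfl⟩ | ⟨p, q, m, n, rfl⟩)
    · exact h (Sum.inl p) (Sum.inl q) m (n + ℓ) (by simp [blk]) (Nat.le_add_left _ _)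
    · exact h (Sum.inr p) (Sum.inr q) m (ℓ + n) (by simp only [blk, Sum.elim_inr]; decide)
        (Nat.le_add_right _ _)
  · rw [RkPart, if_neg one_ne_zero, Submodule.span_le]
    rintro _ (⟨p, q, m, n, rfl⟩ | ⟨p, q, m, n, rfl⟩)
    · exact h (Sum.inl p) (Sum.inr q) m (ℓ + n) (by simp [blk]) (Nat.le_add_right _ _)
    · exact h (Sum.inr q) (Sum.inl p) m (ℓ + n) (by simp [blk]) (Nat.le_add_right _ _)

theorem RkPart_le_Rk (ℓ : ℕ) (i : ZMod 2) : RkPart F k₁ k₂ ℓ i ≤ Rk F k₁ k₂ ℓ :=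
  RkPart_le fun p q m n _ h => mono_mem_Rk p q m n h

theorem RkPart_induction {ℓ : ℕ} {i : ZMod 2} {P : M2Poly (Mat F k₁ k₂) → Prop} (zero : P 0)
    (add : ∀ f g, P f → P g → P (f + g)) (smul : ∀ (c : F) f, P f → P (c • f))
    (basis : ∀ (p q : Fin k₁ ⊕ Fin k₂) (m n : ℕ), blk p + blk q = i → ℓ ≤ n →
      P (mono F p q m n)) (f : M2Poly (Mat F k₁ k₂)) (hf : f ∈ RkPart F k₁ k₂ ℓ i) : P f :=
  RkPart_le (T := Submodule.mk (AddSubmonoid.mk (AddSubsemigroup.mk {f | P f} (fun hf hg => add _ _ hf hg))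
    zero) (fun c f hf => smul c f hf)) basis hf

theorem Rk_induction {ℓ : ℕ} {P : M2Poly (Mat F k₁ k₂) → Prop} (zero : P 0)
    (add : ∀ f g, P f → P g → P (f + g)) (smul : ∀ (c : F) f, P f → P (c • f))
    (basis : ∀ (p q : Fin k₁ ⊕ Fin k₂) (m n : ℕ), ℓ ≤ n → P (mono F p q m n))
    (f : M2Poly (Mat F k₁ k₂)) (hf : f ∈ Rk F k₁ k₂ ℓ) : P f :=
  Rk_le F (T := Submodule.mk (AddSubmonoid.mk (AddSubsemigroup.mk {f | P f} (fun hf hg => add _ _ hf hg))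
    zero) (fun c f hf => smul c f hf)) basis hf

/-- The entries of a `2×2` matrix over `M_{k×k}(F)` which are compatible with the blocks. -/
def blockEntry : Matrix (ZMod 2) (ZMod 2) (Mat F k₁ k₂) →ₗ[F] Mat F k₁ k₂ where
  toFun U := Matrix.of fun p q => U (blk p) (blk q) p q
  map_add' _ _ := rfl
  map_smul' _ _ := rfl

theorem blockEntry_apply (U : Matrix (ZMod 2) (ZMod 2) (Mat F k₁ k₂)) (p q : Fin k₁ ⊕ Fin k₂) :
    blockEntry U p q = U (blk p) (blk q) p q := rfl

/-- The matrix of polynomials corresponding to an element of `R(A)`, with `t₁^m t₂^n` replaced by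
`x^m y^n / (m! n!)`. -/
noncomputable def Ev (x y : F) : M2Poly (Mat F k₁ k₂) →ₗ[F] Mat F k₁ k₂ :=
  Finsupp.lsum F fun m : ℕ × ℕ => (dpow x m.1 * dpow y m.2) • blockEntry

theorem Ev_mono (x y : F) (p q : Fin k₁ ⊕ Fin k₂) (m n : ℕ) :
    Ev x y (mono F p q m n) = (dpow x m * dpow y n) • E F p q := by
  rw [Ev, mono, elt, Finsupp.lsum_single, LinearMap.smul_apply]
  congr 1
  ext r s
  by_cases h : p = r ∧ q = s
  · obtain ⟨rfl, rfl⟩ := h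
    simp [blockEntry_apply]
  · by_cases h' : blk p = blk r ∧ blk q = blk s
    · simp [blockEntry_apply, h', E]
    · simp [blockEntry_apply, h', E, h]

/-- The conditions on blocks sharpen to equalities of indices because the matrix units multiply to
zero otherwise. The two summands are brought to the same shape, so that `contraction_mul_dpow`
applies to both. -/
theorem nthProd_mono (N : ℕ) (p q r s : Fin k₁ ⊕ Fin k₂) (m₁ m₂ n₁ n₂ : ℕ) :
    nthProd F N (mono F p q m₁ m₂) (mono F r s n₁ n₂) =
      (if q = r then
        (((n₁ * d0 (blk q) + 1 : ℕ) : F) * binom F (-(n₁ : ℤ) - 1 - (d0 (blk q) : ℤ)) m₂) •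
        ∑ a ∈ Finset.range (m₁ + (m₂ + n₁ + d0 (blk q)) + 1),
          (if a + N = m₁ + (m₂ + n₁ + d0 (blk q)) then (a.choose m₁ : F) • mono F p s a n₂ else 0)
        else 0) +
      (if p = s then
        (-(-1 : F) ^ ((blk p + blk q) * (blk r + blk s)).val * (-1) ^ d0 (blk p) *
          (((n₂ * d0 (blk p) + 1 : ℕ) : F) * binom F (-(n₂ : ℤ) - 1 - (d0 (blk p) : ℤ)) m₁)) •
        ∑ a ∈ Finset.range (m₂ + (m₁ + n₂ + d0 (blk p)) + 1),
          (if a + N = m₂ + (m₁ + n₂ + d0 (blk p)) then (a.choose m₂ : F) • mono F r q n₁ a else 0)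
        else 0) := by
  rw [nthProd, LinearMap.mk₂_apply, mono, mono, nthFun_elt]
  congr 1
  · unfold term₁
    by_cases h : q = r
    · subst h
      rw [if_pos rfl, if_pos rfl, ← add_assoc m₁, ← add_assoc m₁]
      simp only [E, Matrix.single_mul_single_same, mul_one, mono]
    · rw [if_neg h]
      simp [E, Matrix.single_mul_single_of_ne _ _ _ _ h, elt_zero]
  · unfold term₂
    by_cases h : p = s
    · subst h
      rw [if_pos rfl, if_pos rfl, show m₂ + (m₁ + n₂ + d0 (blk p)) = m₁ + m₂ + n₂ + d0 (blk p) by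
        omega]
      -- The asymmetric factor of the second summand is the factor of the first up to a sign; the
      -- sign is later absorbed in `contr` at the negative argument -(y + l).
      have hδ : (d1 (blk p) : F) - ((n₂ + 1 : ℕ) : F) * (d0 (blk p) : F) =
          (-1) ^ d0 (blk p) * ((n₂ * d0 (blk p) + 1 : ℕ) : F) := by
        rcases p with p | p <;> simp [blk, d0, d1]
      rw [hδ]
      simp only [E, Matrix.single_mul_single_same, mul_one, mono, mul_assoc]
    · rw [if_neg h]
      simp [E, Matrix.single_mul_single_of_ne _ _ _ _ (Ne.symm h), elt_zero]

theorem partialD_mono (p q : Fin k₁ ⊕ Fin k₂) (m n : ℕ) :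
    partialD F (mono F p q m n) =
      ((m + 1 : ℕ) : F) • mono F p q (m + 1) n + ((n + 1 : ℕ) : F) • mono F p q m (n + 1) := by
  rw [partialD, mono, elt, Finsupp.lsum_single]
  rfl

theorem d0_eq (i : ZMod 2) : d0 i = 0 ∨ d0 i = 1 := by
  unfold d0
  split_ifs <;> simp

/-- The diagonal matrix with entries `t` in the first and `1` in the second block. -/
def contr (k₁ k₂ : ℕ) (t : F) : Mat F k₁ k₂ := Matrix.diagonal fun p => t ^ d0 (blk p)

theorem E_mul_contr_mul_E (t : F) (p q r s : Fin k₁ ⊕ Fin k₂) :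
    E F p q * contr k₁ k₂ t * E F r s = if q = r then t ^ d0 (blk q) • E F p s else 0 := by
  split_ifs with h
  · subst h
    have : E F p q * contr k₁ k₂ t = t ^ d0 (blk q) • E F p q := by
      ext a b
      rw [contr, Matrix.mul_diagonal, Matrix.smul_apply, smul_eq_mul, E, Matrix.single_apply]
      split_ifs with h
      · rw [h.2, mul_comm]
      · simp
    rw [this, Matrix.smul_mul, E, E, Matrix.single_mul_single_same, mul_one, E]
  · simp [E, contr, h]

variable [CharZero F]

/-- The factor m+1 turns x^(m+1)/(m+1)! into x · x^m/m!, and similarly for y. -/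
theorem Ev_partialD {ℓ : ℕ} (x y : F) (f : M2Poly (Mat F k₁ k₂)) (hf : f ∈ Rk F k₁ k₂ ℓ) :
    Ev x y (partialD F f) = (x + y) • Ev x y f := by
  refine Rk_induction (P := fun f => Ev x y (partialD F f) = (x + y) • Ev x y f) (by simp)
    (fun f g hf hg => by simp [hf, hg]) (fun c f hf => by rw [map_smul, map_smul, map_smul, hf,
      smul_comm]) (fun p q m n _ => ?_) f hf
  rw [partialD_mono, map_add, map_smul, map_smul, Ev_mono, Ev_mono, Ev_mono, smul_smul, smul_smul,
    smul_smul, ← add_smul]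
  congr 1
  linear_combination dpow y n * succ_mul_dpow_succ x m + dpow x m * succ_mul_dpow_succ y n

theorem sum_dpow_nthProd_mono (x y l : F) (p q r s : Fin k₁ ⊕ Fin k₂) (m₁ m₂ n₁ n₂ : ℕ) {N : ℕ}
    (hN : m₁ + m₂ + n₁ + n₂ + 1 < N) :
    ∑ n ∈ Finset.range N,
      dpow l n • Ev x y (nthProd F n (mono F p q m₁ m₂) (mono F r s n₁ n₂)) =
    Ev x (-(x + l)) (mono F p q m₁ m₂) * contr k₁ k₂ (x + l) * Ev (x + l) y (mono F r s n₁ n₂) -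
      (-1 : F) ^ ((blk p + blk q) * (blk r + blk s)).val •
      (Ev x (y + l) (mono F r s n₁ n₂) * contr k₁ k₂ (-(y + l)) *
        Ev (-(y + l)) y (mono F p q m₁ m₂)) := by
  simp only [nthProd_mono, map_add, smul_add, Finset.sum_add_distrib]
  have hd : ∀ p : Fin k₁ ⊕ Fin k₂, d0 (blk p) ≤ 1 := fun p => by
    rcases d0_eq (blk p) with h | h <;> omega
  simp only [Ev_mono, Matrix.smul_mul, Matrix.mul_smul, E_mul_contr_mul_E]
  refine Eq.trans ?_ (sub_eq_add_neg _ _).symm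
  refine congrArg₂ (· + ·) ?_ ?_
  · by_cases h : q = r
    · subst h
      have h1 := contraction_mul_dpow (d0_eq (blk q)) n₁ m₂ (x + l)
      simp only [if_true, map_smul, map_sum, apply_ite (Ev x y), map_zero, Ev_mono]
      rw [sum_dpow_expand_smul x l _ _ m₁ (m₂ + n₁ + d0 (blk q)) N (by have := hd q; omega)]
      simp only [smul_smul]
      congr 1
      linear_combination dpow y n₂ * dpow x m₁ * h1
    · simp [h]
  · by_cases h : p = s
    · subst h
      have h1 := contraction_mul_dpow (d0_eq (blk p)) n₂ m₁ (y + l)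
      have h2 : (-(y + l)) ^ d0 (blk p) = (-1) ^ d0 (blk p) * (y + l) ^ d0 (blk p) := neg_pow _ _
      simp only [if_true, map_smul, map_sum, apply_ite (Ev x y), map_zero, Ev_mono,
        mul_comm (dpow x n₁)]
      rw [sum_dpow_expand_smul y l _ _ m₂ (m₁ + n₂ + d0 (blk p)) N (by have := hd p; omega)]
      simp only [smul_smul, ← neg_smul]
      congr 1
      rw [h2]
      linear_combination (-(-1 : F) ^ ((blk p + blk q) * (blk r + blk p)).val *
        (-1) ^ d0 (blk p)) * dpow x n₁ * dpow y m₂ * h1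
    · simp [h, Ne.symm h]

end Evaluation

/-! ### Locality, faithfulness of evaluation, and the bracket formula. -/

section Products

variable {F : Type*} [Field F] {k₁ k₂ : ℕ}

theorem nthProd_locality {ℓ : ℕ} (f : M2Poly (Mat F k₁ k₂)) (hf : f ∈ Rk F k₁ k₂ ℓ)
    (g : M2Poly (Mat F k₁ k₂)) (hg : g ∈ Rk F k₁ k₂ ℓ) :
    ∃ N, ∀ n, N ≤ n → nthProd F n f g = 0 := by
  refine Rk_induction (P := fun f => ∃ N, ∀ n, N ≤ n → nthProd F n f g = 0) ⟨0, by simp⟩ ?_ ?_ ?_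
    f hf
  · rintro f f' ⟨N, h⟩ ⟨N', h'⟩
    refine ⟨max N N', fun n hn => ?_⟩
    rw [map_add, LinearMap.add_apply, h n (le_of_max_le_left hn), h' n (le_of_max_le_right hn),
      add_zero]
  · rintro c f ⟨N, h⟩
    exact ⟨N, fun n hn => by rw [map_smul, LinearMap.smul_apply, h n hn, smul_zero]⟩
  intro p q m₁ m₂ _
  refine Rk_induction (P := fun g => ∃ N, ∀ n, N ≤ n → nthProd F n (mono F p q m₁ m₂) g = 0)
    ⟨0, by simp⟩ ?_ ?_ ?_ g hg
  · rintro f f' ⟨N, h⟩ ⟨N', h'⟩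
    refine ⟨max N N', fun n hn => ?_⟩
    rw [map_add, h n (le_of_max_le_left hn), h' n (le_of_max_le_right hn), add_zero]
  · rintro c f ⟨N, h⟩
    exact ⟨N, fun n hn => by rw [map_smul, h n hn, smul_zero]⟩
  intro r s n₁ n₂ _
  have hd : ∀ p : Fin k₁ ⊕ Fin k₂, d0 (blk p) ≤ 1 := fun p => by
    rcases d0_eq (blk p) with h | h <;> omega
  refine ⟨m₁ + m₂ + n₁ + n₂ + 2, fun n hn => ?_⟩
  have hp := hd p
  have hq := hd q
  rw [nthProd_mono, Finset.sum_eq_zero fun a _ => if_neg (by omega),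
    Finset.sum_eq_zero fun a _ => if_neg (by omega)]
  simp

/-- Only finitely many G n are nonzero, so the individual locality bounds can be added up to a
uniform one. This makes the iterated products in the Jacobi identity finite double sums. -/
theorem exists_forall_eq_zero_of_locality {ℓ : ℕ} {f : M2Poly (Mat F k₁ k₂)}
    (hf : f ∈ Rk F k₁ k₂ ℓ) {G : ℕ → M2Poly (Mat F k₁ k₂)} (hG : ∀ n, G n ∈ Rk F k₁ k₂ ℓ)
    (hN : ∃ N, ∀ n, N ≤ n → G n = 0) :
    ∃ K, (∀ n, K ≤ n → G n = 0) ∧ (∀ n m, K ≤ m → nthProd F m f (G n) = 0) ∧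
      (∀ n m, K ≤ m → nthProd F m (G n) f = 0) := by
  obtain ⟨N, hN⟩ := hN
  choose A hA using fun n => nthProd_locality f hf (G n) (hG n)
  choose B hB using fun n => nthProd_locality (G n) (hG n) f hf
  have hle : ∀ n < N, A n + B n ≤ ∑ n ∈ Finset.range N, (A n + B n) := fun n hn =>
    Finset.single_le_sum (f := fun n => A n + B n) (fun _ _ => Nat.zero_le _)
      (Finset.mem_range.2 hn)
  refine ⟨N + ∑ n ∈ Finset.range N, (A n + B n), fun n hn => hN n (by omega), fun n m hm => ?_,
    fun n m hm => ?_⟩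
  · by_cases hn : n < N
    · exact hA n m (by have := hle n hn; omega)
    · rw [hN n (not_lt.1 hn), map_zero]
  · by_cases hn : n < N
    · exact hB n m (by have := hle n hn; omega)
    · rw [hN n (not_lt.1 hn), map_zero, LinearMap.zero_apply]

theorem Rk_apply_eq_zero {ℓ : ℕ} (f : M2Poly (Mat F k₁ k₂)) (hf : f ∈ Rk F k₁ k₂ ℓ) (m : ℕ × ℕ)
    (i j : ZMod 2) (p q : Fin k₁ ⊕ Fin k₂) (h : ¬(ℓ ≤ m.2 ∧ i = blk p ∧ j = blk q)) :
    f m i j p q = 0 := by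
  refine Rk_induction (P := fun f => f m i j p q = 0) rfl
    (fun f g hf hg => by rw [Finsupp.add_apply]; simp [hf, hg]) (fun c f hf => by
      rw [Finsupp.smul_apply]; simp [hf]) (fun r s a b hb => ?_) f hf
  by_cases hm : (a, b) = m
  · subst hm
    by_cases hij : blk r = i ∧ blk s = j
    · by_cases hrs : r = p ∧ s = q
      · obtain ⟨rfl, rfl⟩ := hrs
        exact absurd ⟨hb, hij.1.symm, hij.2.symm⟩ h
      · simp [mono, elt, hij, E, hrs]
    · simp [mono, elt, hij]
  · simp [mono, elt, hm]

theorem exists_Ev_eq_sum (f : M2Poly (Mat F k₁ k₂)) :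
    ∃ N, (∀ m, ¬ (m.1 < N ∧ m.2 < N) → f m = 0) ∧ ∀ x y, Ev x y f =
      ∑ m ∈ Finset.range N, dpow x m •
        ∑ n ∈ Finset.range N, dpow y n • blockEntry (f (m, n)) := by
  have hN : ∃ N, ∀ m ∈ f.support, m.1 < N ∧ m.2 < N := by
    refine ⟨f.support.sup (fun m => m.1 + m.2) + 1, fun m hm => ?_⟩
    have := Finset.le_sup (f := fun m : ℕ × ℕ => m.1 + m.2) hm
    omega
  obtain ⟨N, hN⟩ := hN
  refine ⟨N, fun m hm => ?_, fun x y => ?_⟩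
  · by_contra h
    exact hm (hN m (Finsupp.mem_support_iff.2 h))
  rw [Ev, Finsupp.lsum_apply, Finsupp.sum_of_support_subset f
    (s := Finset.range N ×ˢ Finset.range N) (fun m hm => by
      simpa using hN m hm) _ (fun m _ => by simp), Finset.sum_product]
  refine Finset.sum_congr rfl fun m _ => ?_
  rw [Finset.smul_sum]
  refine Finset.sum_congr rfl fun n _ => ?_
  rw [LinearMap.smul_apply, smul_smul]

theorem contr_mem_blockGrading (t : F) : contr k₁ k₂ t ∈ blockGrading F k₁ k₂ 0 := by
  intro p q h
  refine Matrix.diagonal_apply_ne _ fun hpq => h ?_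
  subst hpq
  generalize blk p = i
  revert i
  decide

theorem mul_mem_blockGrading {i j : ZMod 2} {M N : Mat F k₁ k₂} (hM : M ∈ blockGrading F k₁ k₂ i)
    (hN : N ∈ blockGrading F k₁ k₂ j) : M * N ∈ blockGrading F k₁ k₂ (i + j) := by
  intro p q h
  rw [Matrix.mul_apply]
  refine Finset.sum_eq_zero fun r _ => ?_
  by_cases h1 : blk p + blk r = i
  · by_cases h2 : blk r + blk q = j
    · refine absurd ?_ h
      rw [← h1, ← h2]
      generalize blk p = a
      generalize blk q = b
      generalize blk r = c
      revert a b c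
      decide
    · rw [hN r q h2, mul_zero]
  · rw [hM p r h1, zero_mul]

theorem Ev_mem_blockGrading {ℓ : ℕ} {i : ZMod 2} (f : M2Poly (Mat F k₁ k₂))
    (hf : f ∈ RkPart F k₁ k₂ ℓ i) (x y : F) : Ev x y f ∈ blockGrading F k₁ k₂ i := by
  refine RkPart_induction (P := fun f => Ev x y f ∈ blockGrading F k₁ k₂ i) (by simp)
    (fun f g hf hg => by rw [map_add]; exact add_mem hf hg) (fun c f hf => by
      rw [map_smul]; exact Submodule.smul_mem _ _ hf) (fun p q m n h _ => ?_) f hf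
  rw [Ev_mono]
  refine Submodule.smul_mem _ _ fun r s hrs => ?_
  rw [E, Matrix.single_apply, if_neg]
  rintro ⟨rfl, rfl⟩
  exact hrs h

theorem RkPart_sup (ℓ : ℕ) (i : ZMod 2) :
    RkPart F k₁ k₂ ℓ i ⊔ RkPart F k₁ k₂ ℓ (i + 1) = Rk F k₁ k₂ ℓ := by
  have hi : ∀ i : ZMod 2, i = 0 ∨ i = 1 := by decide
  rcases hi i with rfl | rfl
  · rfl
  · rw [sup_comm]
    rfl

/-- The associative part of the `λ`-bracket of `f` and `g` at `λ = l`, evaluated at `(x, y)`. -/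
noncomputable def halfBracket (x y l : F) (f g : M2Poly (Mat F k₁ k₂)) : Mat F k₁ k₂ :=
  Ev x (-(x + l)) f * contr k₁ k₂ (x + l) * Ev (x + l) y g

theorem halfBracket_add_left (x y l : F) (f f' g : M2Poly (Mat F k₁ k₂)) :
    halfBracket x y l (f + f') g = halfBracket x y l f g + halfBracket x y l f' g := by
  simp only [halfBracket, map_add, add_mul]

theorem halfBracket_add_right (x y l : F) (f g g' : M2Poly (Mat F k₁ k₂)) :
    halfBracket x y l f (g + g') = halfBracket x y l f g + halfBracket x y l f g' := by
  simp only [halfBracket, map_add, mul_add]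

theorem halfBracket_smul_left (x y l c : F) (f g : M2Poly (Mat F k₁ k₂)) :
    halfBracket x y l (c • f) g = c • halfBracket x y l f g := by
  simp only [halfBracket, map_smul, smul_mul_assoc]

theorem halfBracket_smul_right (x y l c : F) (f g : M2Poly (Mat F k₁ k₂)) :
    halfBracket x y l f (c • g) = c • halfBracket x y l f g := by
  simp only [halfBracket, map_smul, mul_smul_comm]

/-- The sign `(-1)^{ij}`. -/
def koszul (F : Type*) [Field F] (i j : ZMod 2) : F := (-1) ^ (i.val * j.val)

theorem koszul_eq (i j : ZMod 2) : koszul F i j = 1 ∨ koszul F i j = -1 :=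
  neg_one_pow_eq_or F _

theorem koszul_comm (i j : ZMod 2) : koszul F i j = koszul F j i := by
  rw [koszul, koszul, mul_comm]

theorem koszul_add_right (i j k : ZMod 2) :
    koszul F i (j + k) = koszul F i j * koszul F i k := by
  have key : ∀ i j k : ZMod 2, (i.val * (j + k).val) % 2 = (i.val * j.val + i.val * k.val) % 2 := by
    decide
  rw [koszul, koszul, koszul, ← pow_add, neg_one_pow_eq_pow_mod_two, key,
    ← neg_one_pow_eq_pow_mod_two]

theorem koszul_eq_pow_val_mul (i j : ZMod 2) : koszul F i j = (-1) ^ (i * j).val := by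
  have key : ∀ i j : ZMod 2, (i * j).val = i.val * j.val := by decide
  rw [koszul, key]

variable [CharZero F]

/-- The values determine the coefficients of all entries compatible with the blocks, and an element
of `Rk` has no others. -/
theorem eq_zero_of_Ev {ℓ : ℕ} (f : M2Poly (Mat F k₁ k₂)) (hf : f ∈ Rk F k₁ k₂ ℓ)
    (h : ∀ x y, Ev x y f = 0) : f = 0 := by
  obtain ⟨N, hN, hE⟩ := exists_Ev_eq_sum f
  refine Finsupp.ext fun m => ?_
  by_cases hm : m.1 < N ∧ m.2 < N
  · have key : blockEntry (f (m.1, m.2)) = 0 := by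
      refine eq_zero_of_sum_dpow_eq_zero (F := F) (c := fun n => blockEntry (f (m.1, n)))
        (fun y => ?_) m.2 hm.2
      exact eq_zero_of_sum_dpow_eq_zero (F := F)
        (c := fun a => ∑ n ∈ Finset.range N, dpow y n • blockEntry (f (a, n)))
        (fun x => by rw [← hE, h]) m.1 hm.1
    ext i j p q
    by_cases hij : i = blk p ∧ j = blk q
    · obtain ⟨rfl, rfl⟩ := hij
      exact congrFun (congrFun key p) q
    · exact Rk_apply_eq_zero f hf m i j p q fun h => hij h.2
  · exact hN m hm

theorem eq_zero_of_sum_dpow_Ev {ℓ N : ℕ} {u : ℕ → M2Poly (Mat F k₁ k₂)}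
    (hu : ∀ n, u n ∈ Rk F k₁ k₂ ℓ)
    (h : ∀ l x y : F, ∑ n ∈ Finset.range N, dpow l n • Ev x y (u n) = 0) : ∀ n < N, u n = 0 :=
  fun n hn => eq_zero_of_Ev _ (hu n) fun x y =>
    eq_zero_of_sum_dpow_eq_zero (F := F) (c := fun n => Ev x y (u n)) (fun l => h l x y) n hn

/-- The component of the wrong parity takes values that are both block diagonal and block
off-diagonal, hence zero. Parity can therefore be tested on values, where it is multiplicative. -/
theorem mem_RkPart_of_Ev {ℓ : ℕ} {i : ZMod 2} (f : M2Poly (Mat F k₁ k₂)) (hf : f ∈ Rk F k₁ k₂ ℓ)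
    (h : ∀ x y, Ev x y f ∈ blockGrading F k₁ k₂ i) : f ∈ RkPart F k₁ k₂ ℓ i := by
  rw [← RkPart_sup ℓ i] at hf
  obtain ⟨f₀, h₀, f₁, h₁, rfl⟩ := Submodule.mem_sup.1 hf
  have : f₁ = 0 := by
    refine eq_zero_of_Ev f₁ (RkPart_le_Rk _ _ h₁) fun x y => ?_
    have h2 := sub_mem (h x y) (Ev_mem_blockGrading f₀ h₀ x y)
    rw [map_add, add_sub_cancel_left] at h2
    have h3 := Ev_mem_blockGrading f₁ h₁ x y
    ext p q
    by_cases hpq : blk p + blk q = i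
    · exact h3 p q (by rw [hpq]; intro h; exact absurd (left_eq_add.1 h) one_ne_zero)
    · exact h2 p q hpq
  rw [this, add_zero]
  exact h₀

/-- The product formula: `[f_l g]` as a commutator of evaluated matrices. -/
theorem sum_dpow_nthProd {ℓ : ℕ} {i j : ZMod 2} {f g : M2Poly (Mat F k₁ k₂)}
    (hf : f ∈ RkPart F k₁ k₂ ℓ i) (hg : g ∈ RkPart F k₁ k₂ ℓ j) {N : ℕ}
    (hN : ∀ n, N ≤ n → nthProd F n f g = 0) (x y l : F) :
    ∑ n ∈ Finset.range N, dpow l n • Ev x y (nthProd F n f g) =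
      halfBracket x y l f g - koszul F i j • halfBracket x y (-(x + y + l)) g f := by
  have key : ∃ M, ∀ N, M ≤ N → ∑ n ∈ Finset.range N, dpow l n • Ev x y (nthProd F n f g) =
      halfBracket x y l f g - koszul F i j • halfBracket x y (-(x + y + l)) g f := by
    clear hN
    refine RkPart_induction (P := fun f => ∃ M, ∀ N, M ≤ N →
      ∑ n ∈ Finset.range N, dpow l n • Ev x y (nthProd F n f g) =
      halfBracket x y l f g - koszul F i j • halfBracket x y (-(x + y + l)) g f)
      ⟨0, by simp [halfBracket]⟩ ?_ ?_ ?_ f hf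
    · rintro f f' ⟨M, h⟩ ⟨M', h'⟩
      refine ⟨max M M', fun N hN => ?_⟩
      simp only [map_add, LinearMap.add_apply, smul_add, Finset.sum_add_distrib,
        h N (le_of_max_le_left hN), h' N (le_of_max_le_right hN), halfBracket_add_left,
        halfBracket_add_right]
      abel
    · rintro c f ⟨M, h⟩
      refine ⟨M, fun N hN => ?_⟩
      simp only [map_smul, LinearMap.smul_apply, smul_comm _ c, ← Finset.smul_sum, h N hN,
        halfBracket_smul_left, halfBracket_smul_right, ← smul_sub]
    intro p q m₁ m₂ hpq _
    refine RkPart_induction (P := fun g => ∃ M, ∀ N, M ≤ N →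
      ∑ n ∈ Finset.range N, dpow l n • Ev x y (nthProd F n (mono F p q m₁ m₂) g) =
      halfBracket x y l (mono F p q m₁ m₂) g -
        koszul F i j • halfBracket x y (-(x + y + l)) g (mono F p q m₁ m₂))
      ⟨0, by simp [halfBracket]⟩ ?_ ?_ ?_ g hg
    · rintro f f' ⟨M, h⟩ ⟨M', h'⟩
      refine ⟨max M M', fun N hN => ?_⟩
      simp only [map_add, smul_add, Finset.sum_add_distrib,
        h N (le_of_max_le_left hN), h' N (le_of_max_le_right hN), halfBracket_add_left,
        halfBracket_add_right]
      abel
    · rintro c f ⟨M, h⟩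
      refine ⟨M, fun N hN => ?_⟩
      simp only [map_smul, smul_comm _ c, ← Finset.smul_sum, h N hN,
        halfBracket_smul_left, halfBracket_smul_right, ← smul_sub]
    intro r s n₁ n₂ hrs _
    -- The orders of nonzero products are at most the total degree plus 1, the extra 1 coming from
    -- δ_{i,0}.
    refine ⟨m₁ + m₂ + n₁ + n₂ + 2, fun N hN => ?_⟩
    rw [sum_dpow_nthProd_mono x y l p q r s m₁ m₂ n₁ n₂ (by omega), koszul_eq_pow_val_mul, hpq,
      hrs, halfBracket, halfBracket, show x + -(x + y + l) = -(y + l) by ring, neg_neg]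
  obtain ⟨M, hM⟩ := key
  rw [← hM (max M N) (le_max_left _ _)]
  refine Finset.sum_subset (Finset.range_subset_range.2 (le_max_right _ _)) fun n _ hn => ?_
  rw [hN n (by simpa using hn), map_zero, smul_zero]

end Products

/-! ### Parity, translation and skew-symmetry. -/

section Laws

variable {F : Type*} [Field F] {k₁ k₂ : ℕ}

theorem halfBracket_mem {ℓ : ℕ} {i j : ZMod 2} {f g : M2Poly (Mat F k₁ k₂)}
    (hf : f ∈ RkPart F k₁ k₂ ℓ i) (hg : g ∈ RkPart F k₁ k₂ ℓ j) (x y l : F) :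
    halfBracket x y l f g ∈ blockGrading F k₁ k₂ (i + j) := by
  have := mul_mem_blockGrading (mul_mem_blockGrading (Ev_mem_blockGrading f hf x (-(x + l)))
    (contr_mem_blockGrading (x + l))) (Ev_mem_blockGrading g hg (x + l) y)
  rwa [add_zero] at this

theorem partialD_pow_mem_Rk {ℓ : ℕ} (s : ℕ) {f : M2Poly (Mat F k₁ k₂)}
    (hf : f ∈ Rk F k₁ k₂ ℓ) : (partialD F ^ s) f ∈ Rk F k₁ k₂ ℓ := by
  induction s with
  | zero => simpa using hf
  | succ s ih =>
    rw [pow_succ', Module.End.mul_apply]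
    exact partialD_mem_Rk F k₁ k₂ ℓ _ ih

variable [CharZero F]

theorem partialD_mem_RkPart {ℓ : ℕ} {i : ZMod 2} {f : M2Poly (Mat F k₁ k₂)}
    (hf : f ∈ RkPart F k₁ k₂ ℓ i) : partialD F f ∈ RkPart F k₁ k₂ ℓ i := by
  have hf' := RkPart_le_Rk _ _ hf
  refine mem_RkPart_of_Ev _ (partialD_mem_Rk F k₁ k₂ ℓ f hf') fun x y => ?_
  rw [Ev_partialD x y f hf']
  exact Submodule.smul_mem _ _ (Ev_mem_blockGrading f hf x y)

theorem nthProd_mem_RkPart {ℓ : ℕ} {i j : ZMod 2} {f g : M2Poly (Mat F k₁ k₂)}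
    (hf : f ∈ RkPart F k₁ k₂ ℓ i) (hg : g ∈ RkPart F k₁ k₂ ℓ j) (n : ℕ) :
    nthProd F n f g ∈ RkPart F k₁ k₂ ℓ (i + j) := by
  have hf' := RkPart_le_Rk _ _ hf
  have hg' := RkPart_le_Rk _ _ hg
  refine mem_RkPart_of_Ev _ (nthProd_mem_Rk F k₁ k₂ ℓ n f hf' g hg') fun x y p q hpq => ?_
  obtain ⟨N, hN⟩ := nthProd_locality f hf' g hg'
  by_cases hn : n < N
  · refine eq_zero_of_sum_dpow_eq_zero (F := F) (N := N)
      (c := fun n => Ev x y (nthProd F n f g) p q) (fun l => ?_) n hn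
    have h : (∑ n ∈ Finset.range N, dpow l n • Ev x y (nthProd F n f g)) p q = 0 := by
      rw [sum_dpow_nthProd hf hg hN x y l]
      exact sub_mem (halfBracket_mem hf hg x y l) (Submodule.smul_mem _ _ (by
        rw [add_comm i j]; exact halfBracket_mem hg hf x y _)) p q hpq
    rw [Matrix.sum_apply] at h
    exact h
  · rw [hN n (not_lt.1 hn), map_zero, Matrix.zero_apply]

theorem nthProd_partialD_of_mem_RkPart {ℓ : ℕ} {i j : ZMod 2} {f g : M2Poly (Mat F k₁ k₂)}
    (hf : f ∈ RkPart F k₁ k₂ ℓ i) (hg : g ∈ RkPart F k₁ k₂ ℓ j) :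
    nthProd F 0 (partialD F f) g = 0 ∧ ∀ n, nthProd F (n + 1) (partialD F f) g =
      -((n + 1 : ℕ) : F) • nthProd F n f g := by
  have hf' := RkPart_le_Rk _ _ hf
  have hg' := RkPart_le_Rk _ _ hg
  have hDf := partialD_mem_RkPart hf
  have hDf' := RkPart_le_Rk _ _ hDf
  obtain ⟨N₁, hN₁⟩ := nthProd_locality f hf' g hg'
  obtain ⟨N₂, hN₂⟩ := nthProd_locality _ hDf' g hg'
  -- One sequence covers both claims: at n = 0 the coefficient is 0, so the truncated n - 1 is
  -- harmless.
  let u : ℕ → M2Poly (Mat F k₁ k₂) := fun n => nthProd F n (partialD F f) g +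
    (n : F) • nthProd F (n - 1) f g
  have hu : ∀ n, u n ∈ Rk F k₁ k₂ ℓ := by
    intro n
    exact add_mem (nthProd_mem_Rk F k₁ k₂ ℓ n _ hDf' g hg')
      (Submodule.smul_mem _ _ (nthProd_mem_Rk F k₁ k₂ ℓ _ _ hf' g hg'))
  -- Multiplication by l shifts the index, so K terms for f match K + 1 terms for ∂f. Leaving K free
  -- lets every n be reached.
  have key : ∀ K, max N₁ N₂ ≤ K → ∀ n < K + 1, u n = 0 := by
    intro K hK
    refine eq_zero_of_sum_dpow_Ev hu fun l x y => ?_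
    have e1 := sum_dpow_nthProd hf hg
      (fun n hn => hN₁ n ((le_of_max_le_left hK).trans hn)) x y l
    have e2 := sum_dpow_nthProd hDf hg
      (fun n (hn : K + 1 ≤ n) => hN₂ n ((le_of_max_le_right hK).trans (by omega))) x y l
    simp only [u, map_add, smul_add, Finset.sum_add_distrib]
    rw [e2, Finset.sum_range_succ']
    have e3 : ∀ n, dpow l (n + 1) • Ev x y (((n + 1 : ℕ) : F) • nthProd F n f g) =
        l • dpow l n • Ev x y (nthProd F n f g) := by
      intro n
      rw [map_smul, smul_smul, smul_smul, mul_comm, succ_mul_dpow_succ]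
    simp only [Nat.add_sub_cancel, e3, Nat.cast_zero, zero_smul, map_zero, smul_zero, add_zero]
    rw [← Finset.smul_sum, e1]
    -- The arguments of f in the two terms are (x, -(x+l)) and (-(y+l), y), each with sum -l.
    simp only [halfBracket, Ev_partialD _ _ f hf', smul_mul_assoc, mul_smul_comm]
    module
  constructor
  · have := key _ le_rfl 0 (Nat.succ_pos _)
    simpa [u] using this
  · intro n
    have := key (max N₁ N₂ + n + 1) (by omega) (n + 1) (by omega)
    rw [neg_smul]
    exact eq_neg_of_add_eq_zero_left this

theorem nthProd_partialD {ℓ : ℕ} {f g : M2Poly (Mat F k₁ k₂)}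
    (hf : f ∈ Rk F k₁ k₂ ℓ) (hg : g ∈ Rk F k₁ k₂ ℓ) :
    nthProd F 0 (partialD F f) g = 0 ∧ ∀ n, nthProd F (n + 1) (partialD F f) g =
      -((n + 1 : ℕ) : F) • nthProd F n f g := by
  refine Rk_induction (P := fun f => nthProd F 0 (partialD F f) g = 0 ∧ ∀ n,
    nthProd F (n + 1) (partialD F f) g = -((n + 1 : ℕ) : F) • nthProd F n f g) (by simp)
    (fun f f' h h' => ?_) (fun c f h => ?_) (fun p q m₁ m₂ h => ?_) f hf
  · simp only [map_add, LinearMap.add_apply, h.1, h'.1, add_zero, h.2, h'.2, smul_add, true_and,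
      implies_true]
  · simp only [map_smul, LinearMap.smul_apply, h.1, h.2, smul_zero, true_and]
    exact fun n => smul_comm _ _ _
  refine Rk_induction (P := fun g => nthProd F 0 (partialD F (mono F p q m₁ m₂)) g = 0 ∧ ∀ n,
    nthProd F (n + 1) (partialD F (mono F p q m₁ m₂)) g =
      -((n + 1 : ℕ) : F) • nthProd F n (mono F p q m₁ m₂) g) (by simp)
    (fun f f' h h' => ?_) (fun c f h => ?_) (fun r s n₁ n₂ h' => ?_) g hg
  · simp only [map_add, h.1, h'.1, add_zero, h.2, h'.2, smul_add, true_and, implies_true]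
  · simp only [map_smul, h.1, h.2, smul_zero, true_and]
    exact fun n => smul_comm _ _ _
  exact nthProd_partialD_of_mem_RkPart (mono_mem_RkPart p q m₁ m₂ h)
    (mono_mem_RkPart r s n₁ n₂ h')

theorem Ev_partialD_pow {ℓ : ℕ} (s : ℕ) (x y : F) {f : M2Poly (Mat F k₁ k₂)}
    (hf : f ∈ Rk F k₁ k₂ ℓ) : Ev x y ((partialD F ^ s) f) = (x + y) ^ s • Ev x y f := by
  induction s with
  | zero => simp
  | succ s ih =>
    rw [pow_succ', Module.End.mul_apply, Ev_partialD x y _ (partialD_pow_mem_Rk s hf), ih, smul_smul,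
      pow_succ']

/-- In generating functions the right hand side is the bracket of g and f at -l-∂, up to sign, and ∂
evaluates to x+y. At this parameter the two halves of the supercommutator trade places. -/
theorem nthProd_skew {ℓ : ℕ} {i j : ZMod 2} {f g : M2Poly (Mat F k₁ k₂)}
    (hf : f ∈ RkPart F k₁ k₂ ℓ i) (hg : g ∈ RkPart F k₁ k₂ ℓ j) {N : ℕ}
    (hN : ∀ n, N ≤ n → nthProd F n g f = 0) (n : ℕ) :
    nthProd F n f g = koszul F i j • ∑ s ∈ Finset.range N,
      ((-1 : F) ^ (n + s + 1) * ((s.factorial : F))⁻¹) •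
        (partialD F ^ s) (nthProd F (n + s) g f) := by
  have hf' := RkPart_le_Rk _ _ hf
  have hg' := RkPart_le_Rk _ _ hg
  obtain ⟨N', hN'⟩ := nthProd_locality f hf' g hg'
  have hY := fun n => nthProd_mem_Rk F k₁ k₂ ℓ n _ hg' f hf'
  let u : ℕ → M2Poly (Mat F k₁ k₂) := fun n => nthProd F n f g - koszul F i j •
    ∑ s ∈ Finset.range N, ((-1 : F) ^ (n + s + 1) * ((s.factorial : F))⁻¹) •
        (partialD F ^ s) (nthProd F (n + s) g f)
  have hu : ∀ n, u n ∈ Rk F k₁ k₂ ℓ := fun n =>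
    sub_mem (nthProd_mem_Rk F k₁ k₂ ℓ n _ hf' g hg') (Submodule.smul_mem _ _
      (Submodule.sum_mem _ fun s _ => Submodule.smul_mem _ _ (partialD_pow_mem_Rk s (hY _))))
  refine sub_eq_zero.1 (eq_zero_of_sum_dpow_Ev (N := max N N' + n + 1) (u := u) hu
    (fun l x y => ?_) n (by omega))
  have e1 := sum_dpow_nthProd hf hg (N := max N N' + n + 1) (fun n hn => hN' n (by omega)) x y l
  have e2 := sum_dpow_nthProd hg hf hN x y (-l + -(x + y))
  have e3 := sum_dpow_add (-l) (-(x + y)) (fun t => Ev x y (nthProd F t g f))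
    (K := N) (N₁ := max N N' + n + 1) (N₂ := N) (by omega) le_rfl
    (fun t ht => by rw [hN t ht, map_zero])
  simp only [u, map_sub, smul_sub, Finset.sum_sub_distrib]
  rw [e1]
  have e4 : ∀ n, dpow l n • Ev x y (koszul F i j • ∑ s ∈ Finset.range N,
      ((-1 : F) ^ (n + s + 1) * ((s.factorial : F))⁻¹) •
        (partialD F ^ s) (nthProd F (n + s) g f)) =
      -koszul F i j • ∑ s ∈ Finset.range N, (dpow (-l) n * dpow (-(x + y)) s) •
        Ev x y (nthProd F (n + s) g f) := by
    intro n
    rw [map_smul, map_sum, smul_comm, neg_smul, ← smul_neg, ← Finset.sum_neg_distrib,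
      Finset.smul_sum]
    congr 1
    refine Finset.sum_congr rfl fun s _ => ?_
    rw [map_smul, Ev_partialD_pow s x y (hY _), smul_smul, smul_smul, ← neg_smul, dpow_neg,
      dpow_neg]
    congr 1
    simp only [dpow, pow_add]
    ring
  rw [Finset.sum_congr rfl fun n _ => e4 n, ← Finset.smul_sum, e3, e2, koszul_comm j i,
    show -(x + y + (-l + -(x + y))) = l by ring, show -(x + y + l) = -l + -(x + y) by ring]
  rcases koszul_eq (F := F) i j with h | h <;> rw [h] <;> module

end Laws

/-! ### The Jacobi identity from associativity. -/

section Jacobi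

variable {F : Type*} [Field F] [CharZero F] {k₁ k₂ : ℕ}

/-- The bracket formula is linear in the second factor, so a generating function of that factor may
be summed inside, at the shifted points. With G n = g_n h this is the nested bracket; the companion
below treats the first factor. -/
theorem sum_sum_dpow_nthProd_right {ℓ : ℕ} {i j : ZMod 2} {f : M2Poly (Mat F k₁ k₂)}
    {G : ℕ → M2Poly (Mat F k₁ k₂)} (hf : f ∈ RkPart F k₁ k₂ ℓ i)
    (hG : ∀ n, G n ∈ RkPart F k₁ k₂ ℓ j) {N : ℕ} (M : ℕ)
    (hN : ∀ n m, N ≤ m → nthProd F m f (G n) = 0) (b : ℕ → F) (x y l : F) :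
    ∑ n ∈ Finset.range M, b n • ∑ m ∈ Finset.range N, dpow l m • Ev x y (nthProd F m f (G n)) =
      Ev x (-(x + l)) f * contr k₁ k₂ (x + l) *
          (∑ n ∈ Finset.range M, b n • Ev (x + l) y (G n)) -
        koszul F i j • ((∑ n ∈ Finset.range M, b n • Ev x (y + l) (G n)) *
          contr k₁ k₂ (-(y + l)) * Ev (-(y + l)) y f) := by
  have h : ∀ n, ∑ m ∈ Finset.range N, dpow l m • Ev x y (nthProd F m f (G n)) = _ := fun n =>
    sum_dpow_nthProd hf (hG n) (hN n) x y l
  simp only [h, halfBracket, smul_sub, Finset.sum_sub_distrib, Finset.mul_sum, Finset.sum_mul,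
    mul_smul_comm, smul_mul_assoc, Finset.smul_sum, smul_comm (koszul F i j),
    show x + -(x + y + l) = -(y + l) by ring, neg_neg]

theorem sum_sum_dpow_nthProd_left {ℓ : ℕ} {i j : ZMod 2} {f : M2Poly (Mat F k₁ k₂)}
    {G : ℕ → M2Poly (Mat F k₁ k₂)} (hf : f ∈ RkPart F k₁ k₂ ℓ i)
    (hG : ∀ n, G n ∈ RkPart F k₁ k₂ ℓ j) {N : ℕ} (M : ℕ)
    (hN : ∀ n m, N ≤ m → nthProd F m (G n) f = 0) (b : ℕ → F) (x y l : F) :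
    ∑ n ∈ Finset.range M, b n • ∑ m ∈ Finset.range N, dpow l m • Ev x y (nthProd F m (G n) f) =
      (∑ n ∈ Finset.range M, b n • Ev x (-(x + l)) (G n)) * contr k₁ k₂ (x + l) *
          Ev (x + l) y f -
        koszul F j i • (Ev x (y + l) f * contr k₁ k₂ (-(y + l)) *
          (∑ n ∈ Finset.range M, b n • Ev (-(y + l)) y (G n))) := by
  have h : ∀ n, ∑ m ∈ Finset.range N, dpow l m • Ev x y (nthProd F m (G n) f) = _ := fun n =>
    sum_dpow_nthProd (hG n) hf (hN n) x y l
  simp only [h, halfBracket, smul_sub, Finset.sum_sub_distrib, Finset.mul_sum, Finset.sum_mul,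
    mul_smul_comm, smul_mul_assoc, Finset.smul_sum, smul_comm (koszul F j i),
    show x + -(x + y + l) = -(y + l) by ring, neg_neg]

/-- Summation of the right hand side of the Jacobi identity. -/
theorem sum_dpow_choose {V : Type*} [AddCommGroup V] [Module F V] (B : ℕ → ℕ → V) (a b : F)
    {K : ℕ} (hB : ∀ s t, K ≤ s → B s t = 0) (hB' : ∀ s t, K ≤ t → B s t = 0) :
    ∑ m ∈ Finset.range (2 * K), ∑ n ∈ Finset.range (2 * K), (dpow a m * dpow b n) •
      ∑ s ∈ Finset.range (m + 1), (m.choose s : F) • B s (m + n - s) =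
    ∑ s ∈ Finset.range K, dpow a s • ∑ t ∈ Finset.range K, dpow (a + b) t • B s t := by
  have e1 : ∀ m ∈ Finset.range (2 * K), ∑ n ∈ Finset.range (2 * K), (dpow a m * dpow b n) •
      ∑ s ∈ Finset.range (m + 1), (m.choose s : F) • B s (m + n - s) =
      ∑ s ∈ Finset.range (m + 1), dpow a s • ∑ n ∈ Finset.range (2 * K),
        (dpow a (m - s) * dpow b n) • B s (m - s + n) := by
    intro m _
    simp only [Finset.smul_sum]
    rw [Finset.sum_comm]
    refine Finset.sum_congr rfl fun s hs => Finset.sum_congr rfl fun n _ => ?_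
    have hs' := Nat.lt_succ_iff.1 (Finset.mem_range.1 hs)
    rw [smul_smul, smul_smul, show m + n - s = m - s + n by omega]
    congr 1
    linear_combination dpow b n * choose_mul_dpow_sub a hs'
  rw [Finset.sum_congr rfl e1, Finset.sum_range_diag_flip (2 * K) fun s i => dpow a s •
    ∑ n ∈ Finset.range (2 * K), (dpow a i * dpow b n) • B s (i + n),
    ← Finset.sum_subset (Finset.range_subset_range.2 (show K ≤ 2 * K by omega)) fun s _ hs => ?_]
  · refine Finset.sum_congr rfl fun s hs => ?_
    have hs' := Finset.mem_range.1 hs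
    -- For s < K the range 2K - s left for the other index still has length at least K, which is why
    -- the outer sums run up to 2K.
    rw [← Finset.smul_sum, sum_dpow_add a b (B s) (K := K) (by omega) (by omega) (hB' s)]
  · refine Finset.sum_eq_zero fun i _ => ?_
    rw [Finset.sum_eq_zero, smul_zero]
    intro n _
    rw [hB s _ (by simpa using hs), smul_zero]

theorem nthProd_jacobi {ℓ : ℕ} {i j k : ZMod 2} {f g h : M2Poly (Mat F k₁ k₂)}
    (hf : f ∈ RkPart F k₁ k₂ ℓ i) (hg : g ∈ RkPart F k₁ k₂ ℓ j) (hh : h ∈ RkPart F k₁ k₂ ℓ k)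
    (m n : ℕ) :
    nthProd F m f (nthProd F n g h) - koszul F i j • nthProd F n g (nthProd F m f h) =
      ∑ s ∈ Finset.range (m + 1), (m.choose s : F) •
        nthProd F (m + n - s) (nthProd F s f g) h := by
  have hf' := RkPart_le_Rk _ _ hf
  have hg' := RkPart_le_Rk _ _ hg
  have hh' := RkPart_le_Rk _ _ hh
  have mem : ∀ {f g : M2Poly (Mat F k₁ k₂)}, f ∈ Rk F k₁ k₂ ℓ → g ∈ Rk F k₁ k₂ ℓ → ∀ n,
    nthProd F n f g ∈ Rk F k₁ k₂ ℓ := fun hf hg n => nthProd_mem_Rk F k₁ k₂ ℓ n _ hf _ hg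
  obtain ⟨K₁, a₁, b₁, -⟩ := exists_forall_eq_zero_of_locality hf' (mem hg' hh')
    (nthProd_locality g hg' h hh')
  obtain ⟨K₂, a₂, b₂, -⟩ := exists_forall_eq_zero_of_locality hg' (mem hf' hh')
    (nthProd_locality f hf' h hh')
  obtain ⟨K₃, a₃, -, b₃⟩ := exists_forall_eq_zero_of_locality hh' (mem hf' hg')
    (nthProd_locality f hf' g hg')
  obtain ⟨K, h₁, h₂, h₃, hm, hn⟩ : ∃ K, K₁ ≤ K ∧ K₂ ≤ K ∧ K₃ ≤ K ∧ m < K ∧ n < K :=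
    ⟨K₁ + K₂ + K₃ + m + n + 1, by omega, by omega, by omega, by omega, by omega⟩
  let T : ℕ → ℕ → M2Poly (Mat F k₁ k₂) := fun m n =>
    nthProd F m f (nthProd F n g h) - koszul F i j • nthProd F n g (nthProd F m f h) -
      ∑ s ∈ Finset.range (m + 1), (m.choose s : F) •
        nthProd F (m + n - s) (nthProd F s f g) h
  -- The defect T of the identity lies in `Rk`, so it vanishes once its double generating function
  -- in l and u vanishes at all points (x, y).
  have hT : ∀ m n, T m n ∈ Rk F k₁ k₂ ℓ := fun m n =>
    sub_mem (sub_mem (mem hf' (mem hg' hh' _) _)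
      (Submodule.smul_mem _ _ (mem hg' (mem hf' hh' _) _)))
      (Submodule.sum_mem _ fun s _ => Submodule.smul_mem _ _ (mem (mem hf' hg' _) hh' _))
  refine sub_eq_zero.1 (eq_zero_of_Ev (T m n) (hT m n) fun x y => ?_)
  refine eq_zero_of_sum_dpow_eq_zero (F := F) (N := 2 * K) (c := fun n => Ev x y (T m n))
    (fun u => ?_) n (by omega)
  refine eq_zero_of_sum_dpow_eq_zero (F := F) (N := 2 * K) (c := fun m =>
    ∑ n ∈ Finset.range (2 * K), dpow u n • Ev x y (T m n)) (fun l => ?_) m (by omega)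
  have e1 := sum_sum_dpow_nthProd_right hf (fun n => nthProd_mem_RkPart hg hh n) (2 * K)
    (N := 2 * K) (fun n m hm => b₁ n m (by omega)) (dpow u) x y l
  have e2 := sum_sum_dpow_nthProd_right hg (fun n => nthProd_mem_RkPart hf hh n) (2 * K)
    (N := 2 * K) (fun n m hm => b₂ n m (by omega)) (dpow l) x y u
  have e3 := sum_sum_dpow_nthProd_left hh (fun n => nthProd_mem_RkPart hf hg n) K
    (N := K) (fun n m hm => b₃ n m (by omega)) (dpow l) x y (l + u)
  have e4 := sum_dpow_choose (fun s t => Ev x y (nthProd F t (nthProd F s f g) h)) l u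
    (K := K) (fun s t hs => by rw [a₃ s (by omega), map_zero, LinearMap.zero_apply, map_zero])
    (fun s t ht => by rw [b₃ s t (by omega), map_zero])
  have p1 := fun x y => sum_dpow_nthProd hg hh (N := 2 * K) (fun n hn => a₁ n (by omega)) x y u
  have p2 := fun x y => sum_dpow_nthProd hf hh (N := 2 * K) (fun n hn => a₂ n (by omega)) x y l
  have p3 := fun x y => sum_dpow_nthProd hf hg (N := K) (fun n hn => a₃ n (by omega)) x y l
  rw [p1, p1] at e1
  rw [p2, p2] at e2
  rw [← e4, p3, p3] at e3
  have split : ∑ m ∈ Finset.range (2 * K), dpow l m •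
      ∑ n ∈ Finset.range (2 * K), dpow u n • Ev x y (T m n) =
      (∑ n ∈ Finset.range (2 * K), dpow u n • ∑ m ∈ Finset.range (2 * K),
        dpow l m • Ev x y (nthProd F m f (nthProd F n g h))) -
      koszul F i j • (∑ m ∈ Finset.range (2 * K), dpow l m • ∑ n ∈ Finset.range (2 * K),
        dpow u n • Ev x y (nthProd F n g (nthProd F m f h))) -
      ∑ m ∈ Finset.range (2 * K), ∑ n ∈ Finset.range (2 * K), (dpow l m * dpow u n) •
      ∑ s ∈ Finset.range (m + 1), (m.choose s : F) •
        Ev x y (nthProd F (m + n - s) (nthProd F s f g) h) := by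
    simp only [T, map_sub, map_smul, map_sum, smul_sub, Finset.sum_sub_distrib, Finset.smul_sum,
      smul_smul]
    congr 1
    congr 1
    · rw [Finset.sum_comm]
      simp only [mul_comm]
    · simp only [mul_comm, mul_left_comm]
    · simp only [mul_assoc]
  rw [split, e1, e2, e3, koszul_comm (i + j) k]
  simp only [halfBracket, koszul_add_right]
  rw [koszul_comm j i, koszul_comm k i, koszul_comm k j]
  -- Both sides now consist of triple products of f, g, h in various orders; normalizing the
  -- evaluation points makes equal products syntactically equal.
  simp only [show x + l + -(x + l + y + u) = -(y + u) by ring,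
    show x + -(x + (y + l) + u) = -(y + l + u) by ring,
    show x + u + -(x + u + y + l) = -(y + l) by ring,
    show x + -(x + (y + u) + l) = -(y + l + u) by ring,
    show x + -(x + -(x + (l + u)) + l) = x + u by ring,
    show -(y + (l + u)) + l = -(y + u) by ring,
    show -(y + (l + u)) + -(-(y + (l + u)) + y + l) = -(y + l) by ring, neg_neg]
  simp only [show x + (l + u) = x + l + u by ring, show x + u + l = x + l + u by ring,
    show y + (l + u) = y + l + u by ring]
  -- Once the three signs are fixed, only distributivity, associativity and cancellation remain.
  rcases koszul_eq (F := F) i j with hij | hij <;> rcases koszul_eq (F := F) i k with hik | hik <;>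
  rcases koszul_eq (F := F) j k with hjk | hjk <;>
  · simp only [hij, hik, hjk, neg_smul, one_smul, mul_one, mul_neg, neg_neg, mul_sub, sub_mul,
      mul_add, add_mul, sub_neg_eq_add, mul_assoc, neg_sub, neg_add_rev]
    abel

theorem nthProd_jacobi_of_mem_Rk {ℓ : ℕ} {i j : ZMod 2} {f g h : M2Poly (Mat F k₁ k₂)}
    (hf : f ∈ RkPart F k₁ k₂ ℓ i) (hg : g ∈ RkPart F k₁ k₂ ℓ j) (hh : h ∈ Rk F k₁ k₂ ℓ)
    (m n : ℕ) :
    nthProd F m f (nthProd F n g h) - koszul F i j • nthProd F n g (nthProd F m f h) =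
      ∑ s ∈ Finset.range (m + 1), (m.choose s : F) •
        nthProd F (m + n - s) (nthProd F s f g) h := by
  refine Rk_induction (P := fun h => nthProd F m f (nthProd F n g h) -
    koszul F i j • nthProd F n g (nthProd F m f h) = ∑ s ∈ Finset.range (m + 1),
      (m.choose s : F) • nthProd F (m + n - s) (nthProd F s f g) h) (by simp)
    (fun w w' h h' => ?_) (fun c w h => ?_) (fun p q a b hb => ?_) h hh
  · simp only [map_add, smul_add, Finset.sum_add_distrib, ← h, ← h']
    abel
  · simp only [map_smul, smul_comm _ c, ← Finset.smul_sum, ← h, smul_sub]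
  · exact nthProd_jacobi hf hg (mono_mem_RkPart p q a b hb) m n

end Jacobi

/-! ### The conformal superalgebra structure and the basis. -/

section Structure

variable (F : Type*) [Field F] {k₁ k₂ : ℕ}

theorem RkAlg_D_coe {ℓ : ℕ} (f : Rk F k₁ k₂ ℓ) :
    ((RkAlg F k₁ k₂ ℓ).D f : M2Poly (Mat F k₁ k₂)) = partialD F f.1 := rfl

theorem RkAlg_Y_coe {ℓ : ℕ} (n : ℕ) (f g : Rk F k₁ k₂ ℓ) :
    ((RkAlg F k₁ k₂ ℓ).Y n f g : M2Poly (Mat F k₁ k₂)) = nthProd F n f.1 g.1 := rfl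

theorem RkAlg_D_pow_coe {ℓ : ℕ} (s : ℕ) (f : Rk F k₁ k₂ ℓ) :
    (((RkAlg F k₁ k₂ ℓ).D ^ s) f : M2Poly (Mat F k₁ k₂)) = (partialD F ^ s) f.1 := by
  induction s with
  | zero => rfl
  | succ s ih => rw [pow_succ', pow_succ', Module.End.mul_apply, Module.End.mul_apply, RkAlg_D_coe,
      ih]

theorem mem_RkAlg_grade {ℓ : ℕ} {i : ZMod 2} {f : Rk F k₁ k₂ ℓ} :
    f ∈ (RkAlg F k₁ k₂ ℓ).grade i ↔ f.1 ∈ RkPart F k₁ k₂ ℓ i := Iff.rfl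

theorem isInternal_grade_of_isCompl {R : Type*} [AddCommGroup R] [Module F R]
    (C : ConformalData F R) (h : IsCompl (C.grade 0) (C.grade 1)) :
    DirectSum.IsInternal C.grade := by
  have h01 : (0 : ZMod 2) ≠ 1 := by decide
  have huniv : (Set.univ : Set (ZMod 2)) = {0, 1} := by
    have h : ∀ i : ZMod 2, i = 0 ∨ i = 1 := by decide
    exact Set.ext fun i => ⟨fun _ => h i, fun _ => trivial⟩
  exact (DirectSum.isInternal_submodule_iff_isCompl C.grade h01 huniv).2 h

theorem RkAlg_isCompl [CharZero F] (k₁ k₂ ℓ : ℕ) :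
    IsCompl ((RkAlg F k₁ k₂ ℓ).grade 0) ((RkAlg F k₁ k₂ ℓ).grade 1) := by
  refine ⟨?_, ?_⟩
  · rw [Submodule.disjoint_def]
    intro f h₀ h₁
    refine Subtype.ext (eq_zero_of_Ev f.1 f.2 fun x y => ?_)
    have e₀ := Ev_mem_blockGrading _ ((mem_RkAlg_grade F).1 h₀) x y
    have e₁ := Ev_mem_blockGrading _ ((mem_RkAlg_grade F).1 h₁) x y
    ext p q
    by_cases h : blk p + blk q = 0
    · exact e₁ p q (by rw [h]; exact zero_ne_one)
    · exact e₀ p q h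
  · rw [codisjoint_iff, eq_top_iff]
    rintro ⟨f, hf⟩ -
    obtain ⟨f₀, h₀, f₁, h₁, rfl⟩ := Submodule.mem_sup.1 hf
    exact Submodule.mem_sup.2 ⟨⟨f₀, RkPart_le_Rk _ _ h₀⟩, h₀, ⟨f₁, RkPart_le_Rk _ _ h₁⟩, h₁, rfl⟩

theorem RkAlg_isConformalSuperalgebra [CharZero F] (k₁ k₂ ℓ : ℕ) :
    IsConformalSuperalgebra (RkAlg F k₁ k₂ ℓ) where
  internal := isInternal_grade_of_isCompl F _ (RkAlg_isCompl F k₁ k₂ ℓ)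
  D_grade i u hu := partialD_mem_RkPart hu
  Y_grade n i j u hu v hv := nthProd_mem_RkPart hu hv n
  locality u v := by
    obtain ⟨N, hN⟩ := nthProd_locality u.1 u.2 v.1 v.2
    exact ⟨N, fun n hn => Subtype.ext (hN n hn)⟩
  deriv_zero u v := Subtype.ext (nthProd_partialD u.2 v.2).1
  deriv_succ n u v := Subtype.ext ((nthProd_partialD u.2 v.2).2 n)
  skew i j u hu v hv n := by
    obtain ⟨N, hN⟩ := nthProd_locality v.1 v.2 u.1 u.2
    have hN' : ∀ m, N ≤ m → (RkAlg F k₁ k₂ ℓ).Y m v u = 0 := fun m hm => Subtype.ext (hN m hm)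
    rw [finsum_eq_sum_of_support_subset (s := Finset.range N)]
    · refine Subtype.ext ?_
      rw [RkAlg_Y_coe, Submodule.coe_smul, Submodule.coe_sum]
      simp only [Submodule.coe_smul, RkAlg_D_pow_coe, RkAlg_Y_coe]
      exact nthProd_skew hu hv hN n
    · intro s hs
      by_contra h
      refine hs ?_
      simp only
      rw [hN' _ ((show N ≤ s by simpa using h).trans (Nat.le_add_left _ _)), map_zero, smul_zero]
  jacobi i j u hu v hv m n w := by
    refine Subtype.ext ?_
    rw [Submodule.coe_sum, Submodule.coe_sub]
    simp only [Submodule.coe_smul, RkAlg_Y_coe]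
    exact nthProd_jacobi_of_mem_Rk hu hv w.2 m n

theorem mono_ne_zero (p q : Fin k₁ ⊕ Fin k₂) (m n : ℕ) : mono F p q m n ≠ 0 := by
  intro h
  have := congrArg (fun f : M2Poly (Mat F k₁ k₂) => f (m, n) (blk p) (blk q) p q) h
  simp [mono, elt, E] at this

theorem RkAlg_grade_one_ne_bot (hk₁ : 0 < k₁) (hk₂ : 0 < k₂) (ℓ : ℕ) :
    (RkAlg F k₁ k₂ ℓ).grade 1 ≠ ⊥ := by
  intro h
  have hm : RkElt F (Sum.inl ⟨0, hk₁⟩) (Sum.inr ⟨0, hk₂⟩) 0 ℓ le_rfl ∈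
      (RkAlg F k₁ k₂ ℓ).grade 1 := by
    have := mono_mem_RkPart (F := F) (Sum.inl ⟨0, hk₁⟩ : Fin k₁ ⊕ Fin k₂) (Sum.inr ⟨0, hk₂⟩) 0 ℓ
      le_rfl
    rwa [show blk (Sum.inl ⟨0, hk₁⟩ : Fin k₁ ⊕ Fin k₂) + blk (Sum.inr ⟨0, hk₂⟩ : Fin k₁ ⊕ Fin k₂) =
      1 by simp [blk]] at this
  rw [h, Submodule.mem_bot] at hm
  exact mono_ne_zero F _ _ _ _ (congrArg Subtype.val hm)

variable {F}

/-- The expansion of an element of `R_{[k₁,k₂],ℓ+1}` in the basis. -/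
theorem Rk_eq_sum {ℓ : ℕ} (f : M2Poly (Mat F k₁ k₂)) (hf : f ∈ Rk F k₁ k₂ ℓ) :
    f = ∑ m ∈ f.support, ∑ p, ∑ q, f m (blk p) (blk q) p q • mono F p q m.1 m.2 := by
  have key : ∀ (m : ℕ × ℕ), f m = ∑ p, ∑ q, f m (blk p) (blk q) p q •
      Matrix.single (blk p) (blk q) (E F p q) := by
    intro m
    ext i j p q
    simp only [Matrix.sum_apply, Matrix.smul_apply]
    rw [Finset.sum_eq_single p, Finset.sum_eq_single q]
    · by_cases h : i = blk p ∧ j = blk q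
      · obtain ⟨rfl, rfl⟩ := h
        simp [E]
      · rw [Matrix.single_apply, if_neg (fun h' => h ⟨h'.1.symm, h'.2.symm⟩),
          Rk_apply_eq_zero f hf m i j p q (fun h' => h h'.2)]
        simp
    · intro q' _ hq'
      rw [Matrix.single_apply]
      split_ifs <;> simp [E, hq']
    · simp
    · intro p' _ hp'
      refine Finset.sum_eq_zero fun q' _ => ?_
      rw [Matrix.single_apply]
      split_ifs <;> simp [E, hp']
    · simp
  refine Finsupp.ext fun m => ?_
  have h1 : ∀ (a : ℕ × ℕ) (p q : Fin k₁ ⊕ Fin k₂), mono F p q a.1 a.2 m =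
      if a = m then Matrix.single (blk p) (blk q) (E F p q) else 0 := fun a p q => by
    rw [mono, elt, Finsupp.single_apply]
  simp only [Finsupp.finsetSum_apply, Finsupp.smul_apply, h1, smul_ite, smul_zero]
  by_cases hm : m ∈ f.support
  · refine (key m).trans ?_
    rw [Finset.sum_eq_single_of_mem m hm fun a _ ha => by simp [ha]]
    simp only [if_true]
  · rw [Finset.sum_eq_zero, Finsupp.notMem_support_iff.1 hm]
    intro a ha
    have : a ≠ m := fun h => hm (h ▸ ha)
    simp [this]

theorem Rk_exists_sum {ℓ : ℕ} (f : M2Poly (Mat F k₁ k₂)) (hf : f ∈ Rk F k₁ k₂ ℓ) :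
    ∃ (S : Finset ((ℕ × ℕ) × (Fin k₁ ⊕ Fin k₂) × (Fin k₁ ⊕ Fin k₂)))
      (c : (ℕ × ℕ) × (Fin k₁ ⊕ Fin k₂) × (Fin k₁ ⊕ Fin k₂) → F),
      (∀ t ∈ S, c t = f t.1 (blk t.2.1) (blk t.2.2) t.2.1 t.2.2 ∧ c t ≠ 0 ∧ ℓ ≤ t.1.2) ∧
      f = ∑ t ∈ S, c t • mono F t.2.1 t.2.2 t.1.1 t.1.2 := by
  classical
  refine ⟨(f.support ×ˢ Finset.univ).filter fun t =>
    f t.1 (blk t.2.1) (blk t.2.2) t.2.1 t.2.2 ≠ 0,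
    fun t => f t.1 (blk t.2.1) (blk t.2.2) t.2.1 t.2.2, fun t ht => ⟨rfl, ?_, ?_⟩, ?_⟩
  · exact (Finset.mem_filter.1 ht).2
  · by_contra h
    exact (Finset.mem_filter.1 ht).2 (Rk_apply_eq_zero f hf _ _ _ _ _ fun h' => h h'.1)
  · conv_lhs => rw [Rk_eq_sum f hf]
    rw [Finset.sum_filter_of_ne, Finset.sum_product]
    · refine Finset.sum_congr rfl fun m _ => ?_
      exact (Fintype.sum_prod_type fun y : (Fin k₁ ⊕ Fin k₂) × (Fin k₁ ⊕ Fin k₂) =>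
        f m (blk y.1) (blk y.2) y.1 y.2 • mono F y.1 y.2 m.1 m.2).symm
    · intro t _ ht h
      exact ht ((congrArg (· • mono F t.2.1 t.2.2 t.1.1 t.1.2) h).trans (zero_smul F _))

end Structure

/-! ### Leading terms of products and simplicity. -/

section Simplicity

variable {F : Type*} [Field F] {k₁ k₂ : ℕ}

theorem d0_blk_inl (p : Fin k₁) : d0 (blk (Sum.inl p : Fin k₁ ⊕ Fin k₂)) = 1 := by simp [d0, blk]

theorem d0_blk_inr (q : Fin k₂) : d0 (blk (Sum.inr q : Fin k₁ ⊕ Fin k₂)) = 0 := by simp [d0, blk]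

theorem sum_range_ite_add_eq {V : Type*} [AddCommMonoid V] (g : ℕ → V) {T N : ℕ} (h : N ≤ T) :
    ∑ a ∈ Finset.range (T + 1), (if a + N = T then g a else 0) = g (T - N) := by
  rw [Finset.sum_eq_single (T - N), if_pos (by omega)]
  · exact fun b _ hb => if_neg (by omega)
  · exact fun h => absurd (Finset.mem_range.2 (by omega)) h

/-- If N exceeds M, the only index a allowed is below m, where the binomial coefficient vanishes.
This is the mechanism by which a large order switches off one half of a product. -/
theorem sum_range_choose_eq_zero {V : Type*} [AddCommGroup V] [Module F V] (g : ℕ → V)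
    {m M N : ℕ} (h : M < N) :
    ∑ a ∈ Finset.range (m + M + 1), (if a + N = m + M then (a.choose m : F) • g a else 0) = 0 := by
  refine Finset.sum_eq_zero fun a _ => ?_
  split_ifs
  · rw [Nat.choose_eq_zero_of_lt (by omega), Nat.cast_zero, zero_smul]
  · rfl

theorem nthProd_mono_eq_zero {N : ℕ} {p q r s : Fin k₁ ⊕ Fin k₂} {m₁ m₂ n₁ n₂ : ℕ}
    (h₁ : q ≠ r ∨ m₂ + n₁ + d0 (blk q) < N) (h₂ : p ≠ s ∨ m₁ + n₂ + d0 (blk p) < N) :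
    nthProd F N (mono F p q m₁ m₂) (mono F r s n₁ n₂) = 0 := by
  rw [nthProd_mono]
  by_cases hq : q = r
  · rw [sum_range_choose_eq_zero _ (h₁.resolve_left (not_not.2 hq)), smul_zero, ite_self, zero_add]
    by_cases hp : p = s
    · rw [sum_range_choose_eq_zero _ (h₂.resolve_left (not_not.2 hp)), smul_zero, ite_self]
    · rw [if_neg hp]
  · rw [if_neg hq, zero_add]
    by_cases hp : p = s
    · rw [sum_range_choose_eq_zero _ (h₂.resolve_left (not_not.2 hp)), smul_zero, ite_self]
    · rw [if_neg hp]

variable [CharZero F]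

theorem binom_neg_ne_zero (n δ m : ℕ) : binom F (-(n : ℤ) - 1 - (δ : ℤ)) m ≠ 0 := by
  rw [show -(n : ℤ) - 1 - (δ : ℤ) = -((n + δ : ℕ) : ℤ) - 1 by push_cast; ring, binom_neg_sub_one]
  exact mul_ne_zero (pow_ne_zero _ (by norm_num))
    (Nat.cast_ne_zero.2 (Nat.choose_pos (Nat.le_add_right _ _)).ne')

/-- `h` switches off the right multiplication term. The remaining coefficient is nonzero because a
binomial coefficient with negative upper entry never vanishes in characteristic 0. The t₂-degree
comes from the second factor, and j is the gain in t₁-degree over the first. -/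
theorem nthProd_mono_left {N j : ℕ} {p q s : Fin k₁ ⊕ Fin k₂} {m₁ m₂ n₁ n₂ : ℕ}
    (hN : N + j = m₂ + n₁ + d0 (blk q)) (h : p ≠ s ∨ m₁ + n₂ + d0 (blk p) < N) :
    ∃ c : F, c ≠ 0 ∧
      nthProd F N (mono F p q m₁ m₂) (mono F q s n₁ n₂) = c • mono F p s (m₁ + j) n₂ := by
  refine ⟨((n₁ * d0 (blk q) + 1 : ℕ) : F) * binom F (-(n₁ : ℤ) - 1 - (d0 (blk q) : ℤ)) m₂ *
    ((m₁ + j).choose m₁ : F), mul_ne_zero (mul_ne_zero (Nat.cast_ne_zero.2 (Nat.succ_ne_zero _))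
      (binom_neg_ne_zero _ _ _)) (Nat.cast_ne_zero.2
      (Nat.choose_pos (Nat.le_add_right _ _)).ne'), ?_⟩
  rw [nthProd_mono, if_pos rfl, sum_range_ite_add_eq _ (by omega), ← hN, smul_smul,
    show m₁ + (N + j) - N = m₁ + j by omega]
  refine add_eq_left.2 ?_
  by_cases hp : p = s
  · rw [sum_range_choose_eq_zero _ (h.resolve_left (not_not.2 hp)), smul_zero, ite_self]
  · rw [if_neg hp]

theorem nthProd_mono_right {N j : ℕ} {p q r : Fin k₁ ⊕ Fin k₂} {m₁ m₂ n₁ n₂ : ℕ}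
    (hN : N + j = m₁ + n₂ + d0 (blk p)) (h : q ≠ r ∨ m₂ + n₁ + d0 (blk q) < N) :
    ∃ c : F, c ≠ 0 ∧
      nthProd F N (mono F p q m₁ m₂) (mono F r p n₁ n₂) = c • mono F r q n₁ (m₂ + j) := by
  refine ⟨-(-1 : F) ^ ((blk p + blk q) * (blk r + blk p)).val * (-1) ^ d0 (blk p) *
    (((n₂ * d0 (blk p) + 1 : ℕ) : F) * binom F (-(n₂ : ℤ) - 1 - (d0 (blk p) : ℤ)) m₁) *
    ((m₂ + j).choose m₂ : F), mul_ne_zero (mul_ne_zero (mul_ne_zero (neg_ne_zero.2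
      (pow_ne_zero _ (by norm_num))) (pow_ne_zero _ (by norm_num)))
      (mul_ne_zero (Nat.cast_ne_zero.2 (Nat.succ_ne_zero _)) (binom_neg_ne_zero _ _ _)))
      (Nat.cast_ne_zero.2 (Nat.choose_pos (Nat.le_add_right _ _)).ne'), ?_⟩
  rw [nthProd_mono, if_pos (rfl : p = p), sum_range_ite_add_eq (T := m₂ + _) _ (by omega), ← hN,
    smul_smul, show m₂ + (N + j) - N = m₂ + j by omega]
  refine add_eq_right.2 ?_
  by_cases hq : q = r
  · rw [sum_range_choose_eq_zero _ (h.resolve_left (not_not.2 hq)), smul_zero, ite_self]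
  · rw [if_neg hq]

/-- Two products with basis elements move a nonzero element of `R_{[k₁,k₂],ℓ+1}` to a nonzero
multiple of any given basis element. -/
theorem exists_nthProd_nthProd_eq_mono {ℓ : ℕ} {f : M2Poly (Mat F k₁ k₂)}
    (hf : f ∈ Rk F k₁ k₂ ℓ) (hf0 : f ≠ 0) (p p' : Fin k₁ ⊕ Fin k₂) (m n : ℕ) (hn : ℓ ≤ n) :
    ∃ (N₁ N₂ : ℕ) (c : F), ∃ a₁ ∈ Rk F k₁ k₂ ℓ, ∃ a₂ ∈ Rk F k₁ k₂ ℓ, c ≠ 0 ∧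
      nthProd F N₂ a₂ (nthProd F N₁ a₁ f) = c • mono F p p' m n := by
  obtain ⟨S, c, hc, hfS⟩ := Rk_exists_sum f hf
  have hS : S.Nonempty := by
    rw [Finset.nonempty_iff_ne_empty]
    rintro rfl
    exact hf0 (by simpa using hfS)
  obtain ⟨t₀, ht₀⟩ := hS
  -- Leading term of f: fix a row that occurs and its top t₁-degree d₁; then, within one column and
  -- this t₁-degree, take the top t₂-degree d₂.
  obtain ⟨t₁, ht₁, hmax₁⟩ := Finset.exists_max_image (S.filter fun t => t.2.1 = t₀.2.1)
    (fun t => t.1.1) ⟨t₀, by simp [ht₀]⟩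
  obtain ⟨t₂, ht₂, hmax₂⟩ := Finset.exists_max_image (S.filter fun t => t.2 = t₁.2 ∧
    t.1.1 = t₁.1.1) (fun t => t.1.2) ⟨t₁, by simpa using (Finset.mem_filter.1 ht₁).1⟩
  simp only [Finset.mem_filter] at ht₁ ht₂ hmax₁ hmax₂
  obtain ⟨⟨d₁, d₂⟩, q, q'⟩ := t₂
  simp only at ht₂
  obtain ⟨ht₂, hq, hd₁⟩ := ht₂
  rw [← hq, ← hd₁] at hmax₂
  simp only at hmax₂
  rw [← ht₁.2, ← hq, ← hd₁] at hmax₁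
  simp only at hmax₁
  obtain ⟨B, hB⟩ : ∃ B, ∀ t ∈ S, t.1.1 + t.1.2 ≤ B :=
    ⟨S.sup fun t => t.1.1 + t.1.2, fun t ht => Finset.le_sup (f := fun t => t.1.1 + t.1.2) ht⟩
  have hd : ∀ p : Fin k₁ ⊕ Fin k₂, d0 (blk p) ≤ 1 := fun p => by
    rcases d0_eq (blk p) with h | h <;> omega
  -- The order is the largest one at which left multiplication sees t₁-degree d₁ in row q, so
  -- smaller degrees die. The t₂-exponent B + m + ℓ + 2 is at least ℓ and pushes the order beyond
  -- the reach of right multiplication.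
  have step₁ : ∀ t ∈ S, ∃ k : F, k ≠ 0 ∧ nthProd F (B + m + ℓ + 2 + d₁ + d0 (blk q))
      (mono F p q m (B + m + ℓ + 2)) (mono F t.2.1 t.2.2 t.1.1 t.1.2) =
      if t.2.1 = q ∧ t.1.1 = d₁ then k • mono F p t.2.2 m t.1.2 else 0 := by
    intro t ht
    have h1 := hB t ht
    have h2 := hd p
    by_cases h : t.2.1 = q ∧ t.1.1 = d₁
    · obtain ⟨k, hk, e⟩ := nthProd_mono_left (F := F) (N := B + m + ℓ + 2 + d₁ + d0 (blk q)) (j := 0)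
        (p := p) (q := q) (s := t.2.2) (m₁ := m) (m₂ := B + m + ℓ + 2) (n₁ := d₁) (n₂ := t.1.2) rfl
        (Or.inr (by omega))
      refine ⟨k, hk, ?_⟩
      rw [if_pos h, h.1, h.2]
      exact e
    · refine ⟨1, one_ne_zero, ?_⟩
      rw [if_neg h]
      refine nthProd_mono_eq_zero ?_ (Or.inr (by omega))
      by_cases hq : t.2.1 = q
      · have h3 := hmax₁ t ⟨ht, hq⟩
        have h4 : t.1.1 ≠ d₁ := fun h' => h ⟨hq, h'⟩
        exact Or.inr (by omega)
      · exact Or.inl (Ne.symm hq)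
  choose! k hk step₁ using step₁
  have hBt := hB _ ht₂
  simp only at hBt
  -- The mirror image: right multiplication at the top order for column q' and t₂-degree d₂, with
  -- left multiplication switched off by the large t₁-exponent.
  obtain ⟨k', hk', e'⟩ := nthProd_mono_right (F := F) (N := B + n + m + 2 + d₂ + d0 (blk q'))
    (j := 0) (p := q') (q := p') (r := p) (m₁ := B + n + m + 2) (m₂ := n) (n₁ := m) (n₂ := d₂) rfl
    (Or.inr (by have := hd p'; omega))
  refine ⟨B + m + ℓ + 2 + d₁ + d0 (blk q), B + n + m + 2 + d₂ + d0 (blk q'),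
    c ((d₁, d₂), q, q') * (k ((d₁, d₂), q, q') * k'), mono F p q m (B + m + ℓ + 2),
    mono_mem_Rk _ _ _ _ (by omega), mono F q' p' (B + n + m + 2) n, mono_mem_Rk _ _ _ _ hn,
    mul_ne_zero (hc _ ht₂).2.1 (mul_ne_zero (hk _ ht₂) hk'), ?_⟩
  rw [hfS, map_sum, map_sum, Finset.sum_eq_single_of_mem _ ht₂]
  · rw [map_smul, step₁ _ ht₂, if_pos ⟨rfl, rfl⟩, map_smul, map_smul, e', mul_smul, mul_smul]
    rfl
  · intro t ht hne
    rw [map_smul, step₁ t ht, map_smul]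
    split_ifs with h
    · rw [map_smul, nthProd_mono_eq_zero, smul_zero, smul_zero]
      · exact Or.inr (by have := hd p'; omega)
      · by_cases hq' : t.2.2 = q'
        · have h3 := hmax₂ t ⟨ht, Prod.ext h.1 hq', h.2⟩
          have h4 : t.1.2 ≠ d₂ := fun h' => hne (Prod.ext (Prod.ext h.2 h') (Prod.ext h.1 hq'))
          exact Or.inr (by omega)
        · exact Or.inl (Ne.symm hq')
    · rw [map_zero, smul_zero]

theorem RkAlg_isSimple (k₁ k₂ ℓ : ℕ) : IsSimple (RkAlg F k₁ k₂ ℓ) := by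
  intro I hI
  refine or_iff_not_imp_left.2 fun h => ?_
  obtain ⟨f, hfI, hf0⟩ := (Submodule.ne_bot_iff I).1 h
  rw [eq_top_iff]
  have key : Rk F k₁ k₂ ℓ ≤ I.map (Rk F k₁ k₂ ℓ).subtype := by
    refine Rk_le F fun p q m n hn => ?_
    obtain ⟨N₁, N₂, c, a₁, h₁, a₂, h₂, hc, e⟩ := exists_nthProd_nthProd_eq_mono f.2
      (fun h => hf0 (Subtype.ext h)) p q m n hn
    refine (Submodule.smul_mem_iff _ hc).1 ?_
    exact ⟨_, hI.2 N₂ ⟨a₂, h₂⟩ _ (hI.2 N₁ ⟨a₁, h₁⟩ f hfI), e⟩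
  rintro ⟨g, hg⟩ -
  obtain ⟨g', hg', e⟩ := key hg
  rwa [show (⟨g, hg⟩ : Rk F k₁ k₂ ℓ) = g' from Subtype.ext e.symm]

end Simplicity

/-! ### The subspace of weight ℓ + 3/2. -/

section Weight

variable {F : Type*} [Field F] {k₁ k₂ : ℕ}

theorem weight_eq_of_mem_weightRA {A : Type*} [Ring A] [Algebra F A]
    {𝒜 : ZMod 2 → Submodule F A} {α : ℚ} {f : M2Poly A} (hf : f ∈ weightRA F 𝒜 α) (m : ℕ × ℕ)
    (i j : ZMod 2) (h : f m i j ≠ 0) :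
    (m.1 + m.2 + d0 i + d0 j + (d1 i + d1 j) / 2 : ℚ) = α := by
  contrapose! h
  refine Submodule.span_induction (p := fun f _ => f m i j = 0) ?_ rfl
    (fun f g _ _ hf hg => by rw [Finsupp.add_apply, Matrix.add_apply, hf, hg, add_zero])
    (fun c f _ hf => by rw [Finsupp.smul_apply, Matrix.smul_apply, hf, smul_zero]) hf
  rintro _ ⟨i', j', u, m₁, m₂, -, hw, rfl⟩
  by_cases hm : (m₁, m₂) = m
  · subst hm
    by_cases hij : i' = i ∧ j' = j
    · obtain ⟨rfl, rfl⟩ := hij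
      exact absurd hw h
    · simp [elt, hij]
  · simp [elt, hm]

theorem E_mem_blockGrading (p q : Fin k₁ ⊕ Fin k₂) :
    E F p q ∈ blockGrading F k₁ k₂ (blk p + blk q) := by
  intro r s h
  rw [E, Matrix.single_apply, if_neg]
  rintro ⟨rfl, rfl⟩
  exact h rfl

theorem mem_of_coe_mem_map {M : Type*} [AddCommGroup M] [Module F M] {N : Submodule F M}
    {I : Submodule F N} {x : N} (h : (x : M) ∈ I.map N.subtype) : x ∈ I := by
  obtain ⟨y, hy, e⟩ := h
  rwa [← show y = x from Subtype.ext e]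

theorem RkWeight_eq_span (k₁ k₂ ℓ : ℕ) :
    RkWeight F k₁ k₂ ℓ (ℓ + 3 / 2) =
      Submodule.span F
        ({x | ∃ (p : Fin k₁) (q : Fin k₂), x = RkElt F (Sum.inl p) (Sum.inr q) 0 ℓ le_rfl} ∪
         {x | ∃ (p : Fin k₁) (q : Fin k₂), x = RkElt F (Sum.inr q) (Sum.inl p) 0 ℓ le_rfl}) := by
  refine le_antisymm (fun x hx => ?_) (Submodule.span_le.2 ?_)
  · refine mem_of_coe_mem_map ?_
    obtain ⟨S, c, hc, hxS⟩ := Rk_exists_sum x.1 x.2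
    rw [hxS]
    refine Submodule.sum_mem _ fun t ht => Submodule.smul_mem _ _ ?_
    obtain ⟨hct, hc0, hl⟩ := hc t ht
    have hw := weight_eq_of_mem_weightRA (F := F) (α := ℓ + 3 / 2) hx t.1 (blk t.2.1) (blk t.2.2)
      (fun h => hc0 (hct.trans (congrArg (fun M : Mat F k₁ k₂ => M t.2.1 t.2.2) h)))
    obtain ⟨⟨m, n⟩, p | p, q | q⟩ := t
    -- Elements of the diagonal blocks have integral weight, so doubling gives a parity
    -- contradiction. For odd ones m + n = ℓ, and n ≥ ℓ forces m = 0.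
    · exfalso
      simp only [blk, d0, d1, Sum.elim_inl, if_true, zero_ne_one, if_false] at hw
      have h2 : ((2 * (m + n) + 1 : ℕ) : ℚ) = (2 * ℓ : ℕ) := by push_cast at hw ⊢; linarith
      have h3 := Nat.cast_injective (R := ℚ) h2
      omega
    · simp only [blk, d0, d1, Sum.elim_inl, Sum.elim_inr, if_true, zero_ne_one, one_ne_zero,
        if_false] at hw
      have h2 : ((m + n : ℕ) : ℚ) = ℓ := by push_cast at hw ⊢; linarith
      have h3 := Nat.cast_injective (R := ℚ) h2
      simp only at hl
      obtain ⟨rfl, rfl⟩ : m = 0 ∧ n = ℓ := by omega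
      exact ⟨_, Submodule.subset_span (Or.inl ⟨p, q, rfl⟩), rfl⟩
    · simp only [blk, d0, d1, Sum.elim_inl, Sum.elim_inr, if_true, zero_ne_one, one_ne_zero,
        if_false] at hw
      have h2 : ((m + n : ℕ) : ℚ) = ℓ := by push_cast at hw ⊢; linarith
      have h3 := Nat.cast_injective (R := ℚ) h2
      simp only at hl
      obtain ⟨rfl, rfl⟩ : m = 0 ∧ n = ℓ := by omega
      exact ⟨_, Submodule.subset_span (Or.inr ⟨q, p, rfl⟩), rfl⟩
    · exfalso
      simp only [blk, d0, d1, Sum.elim_inr, if_true, one_ne_zero, if_false] at hw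
      have h2 : ((2 * (m + n) : ℕ) : ℚ) = (2 * ℓ + 1 : ℕ) := by push_cast at hw ⊢; linarith
      have h3 := Nat.cast_injective (R := ℚ) h2
      omega
  · rintro _ (⟨p, q, rfl⟩ | ⟨p, q, rfl⟩)
    · refine Submodule.subset_span ⟨blk (Sum.inl p), blk (Sum.inr q), _, 0, ℓ,
        E_mem_blockGrading _ _, ?_, rfl⟩
      simp only [blk, d0, d1, Sum.elim_inl, Sum.elim_inr, if_true, zero_ne_one, one_ne_zero,
        if_false]
      push_cast
      ring
    · refine Submodule.subset_span ⟨blk (Sum.inr q), blk (Sum.inl p), _, 0, ℓ,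
        E_mem_blockGrading _ _, ?_, rfl⟩
      simp only [blk, d0, d1, Sum.elim_inl, Sum.elim_inr, if_true, zero_ne_one, one_ne_zero,
        if_false]
      push_cast
      ring

end Weight

/-! ### Generation. -/

section Generation

variable {F : Type*} [Field F]

theorem subset_words {R : Type*} [AddCommGroup R] [Module F R] (C : ConformalData F R) (S : Set R) :
    S ⊆ words C S := fun v hv => ⟨[], v, by simp, hv, rfl⟩

theorem Y_mem_span_words {R : Type*} [AddCommGroup R] [Module F R] (C : ConformalData F R)
    (S : Set R) {u : R} (hu : u ∈ S) (n : ℕ) {w : R} (hw : w ∈ Submodule.span F (words C S)) :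
    C.Y n u w ∈ Submodule.span F (words C S) := by
  refine Submodule.span_induction (p := fun w _ => C.Y n u w ∈ Submodule.span F (words C S))
    ?_ (by simp) (fun w w' _ _ h h' => by rw [map_add]; exact add_mem h h')
    (fun c w _ h => by rw [map_smul]; exact Submodule.smul_mem _ _ h) hw
  rintro _ ⟨L, v, hL, hv, rfl⟩
  refine Submodule.subset_span ⟨(n, u) :: L, v, ?_, hv, rfl⟩
  intro x hx
  rcases List.mem_cons.1 hx with rfl | hx
  · exact hu
  · exact hL x hx

variable {k₁ k₂ : ℕ}

/-- `u` lies in `J` and all products with `u` preserve `J`. -/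
def Stab (J : Submodule F (M2Poly (Mat F k₁ k₂))) (u : M2Poly (Mat F k₁ k₂)) : Prop :=
  u ∈ J ∧ ∀ n, ∀ w ∈ J, nthProd F n u w ∈ J

theorem Stab.of_smul {J : Submodule F (M2Poly (Mat F k₁ k₂))} {u : M2Poly (Mat F k₁ k₂)} {c : F}
    (hc : c ≠ 0) (h : Stab J (c • u)) : Stab J u := by
  refine ⟨(Submodule.smul_mem_iff _ hc).1 h.1, fun n w hw => ?_⟩
  have := h.2 n w hw
  rw [map_smul, LinearMap.smul_apply] at this
  exact (Submodule.smul_mem_iff _ hc).1 this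

theorem stab_of_mem {ℓ : ℕ} (S : Set (Rk F k₁ k₂ ℓ)) {u : Rk F k₁ k₂ ℓ} (hu : u ∈ S) :
    Stab ((Submodule.span F (words (RkAlg F k₁ k₂ ℓ) S)).map (Rk F k₁ k₂ ℓ).subtype) u.1 := by
  refine ⟨⟨u, Submodule.subset_span (subset_words _ S hu), rfl⟩, ?_⟩
  rintro n _ ⟨w, hw, rfl⟩
  exact ⟨_, Y_mem_span_words _ S hu n hw, rfl⟩

theorem generatedBy_of_stab {ℓ : ℕ} (S : Set (Rk F k₁ k₂ ℓ)) (h : ∀ a b m n, ℓ ≤ n →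
    Stab ((Submodule.span F (words (RkAlg F k₁ k₂ ℓ) S)).map (Rk F k₁ k₂ ℓ).subtype)
      (mono F a b m n)) : GeneratedBy (RkAlg F k₁ k₂ ℓ) S := by
  rw [GeneratedBy, eq_top_iff]
  exact fun x _ => mem_of_coe_mem_map
    (Rk_le F (fun p q m n hn => (h p q m n hn).1) x.2)

variable [CharZero F]

/-- In the Jacobi identity the term s = m has coefficient 1 and contains the product f_m g; the
other terms involve f_s g with s < m. Strong induction on m thus expresses the action of f_m g
through operations that preserve J. Hence products of stabilizing elements may be bracketed
arbitrarily, whereas words are only nested to the right. -/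
theorem Stab.nthProd {ℓ : ℕ} {J : Submodule F (M2Poly (Mat F k₁ k₂))} (hJ : J ≤ Rk F k₁ k₂ ℓ)
    {i j : ZMod 2} {f g : M2Poly (Mat F k₁ k₂)} (hf : f ∈ RkPart F k₁ k₂ ℓ i)
    (hg : g ∈ RkPart F k₁ k₂ ℓ j) (h : Stab J f) (h' : Stab J g) (m : ℕ) :
    Stab J (nthProd F m f g) := by
  refine ⟨h.2 m g h'.1, ?_⟩
  induction m using Nat.strong_induction_on with
  | _ m ih =>
    intro n w hw
    have e := nthProd_jacobi_of_mem_Rk hf hg (hJ hw) m n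
    rw [Finset.sum_range_succ, Nat.choose_self, Nat.cast_one, one_smul, Nat.add_sub_cancel_left,
      ← sub_eq_iff_eq_add'] at e
    rw [← e]
    refine sub_mem (sub_mem (h.2 _ _ (h'.2 _ _ hw)) (Submodule.smul_mem _ _
      (h'.2 _ _ (h.2 _ _ hw)))) (Submodule.sum_mem _ fun s hs => Submodule.smul_mem _ _ ?_)
    exact ih s (Finset.mem_range.1 hs) _ w hw

variable {ℓ : ℕ} {J : Submodule F (M2Poly (Mat F k₁ k₂))}

theorem Stab.left (hJ : J ≤ Rk F k₁ k₂ ℓ) {p q s : Fin k₁ ⊕ Fin k₂} {m₁ m₂ n₁ n₂ : ℕ}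
    (ha : Stab J (mono F p q m₁ m₂)) (hf : Stab J (mono F q s n₁ n₂)) (hm : ℓ ≤ m₂) (hn : ℓ ≤ n₂)
    (N j : ℕ) (hN : N + j = m₂ + n₁ + d0 (blk q)) (h : p ≠ s ∨ m₁ + n₂ + d0 (blk p) < N) :
    Stab J (mono F p s (m₁ + j) n₂) := by
  obtain ⟨c, hc, e⟩ := nthProd_mono_left (F := F) hN h
  have := Stab.nthProd hJ (mono_mem_RkPart _ _ _ _ hm) (mono_mem_RkPart _ _ _ _ hn) ha hf N
  rw [e] at this
  exact this.of_smul hc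

theorem Stab.right (hJ : J ≤ Rk F k₁ k₂ ℓ) {p q r : Fin k₁ ⊕ Fin k₂} {m₁ m₂ n₁ n₂ : ℕ}
    (ha : Stab J (mono F p q m₁ m₂)) (hf : Stab J (mono F r p n₁ n₂)) (hm : ℓ ≤ m₂) (hn : ℓ ≤ n₂)
    (N j : ℕ) (hN : N + j = m₁ + n₂ + d0 (blk p)) (h : q ≠ r ∨ m₂ + n₁ + d0 (blk q) < N) :
    Stab J (mono F r q n₁ (m₂ + j)) := by
  obtain ⟨c, hc, e⟩ := nthProd_mono_right (F := F) hN h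
  have := Stab.nthProd hJ (mono_mem_RkPart _ _ _ _ hm) (mono_mem_RkPart _ _ _ _ hn) ha hf N
  rw [e] at this
  exact this.of_smul hc

/-- The elements of `h₃` are the means of raising the t₂-degree; a surplus of t₂-degree in a left
factor, or of t₁-degree in a right one, can then be converted into t₁-degree of the product. -/
theorem stab_mono_of_generators (hk₁ : 0 < k₁) (hk₂ : 0 < k₂) (hJ : J ≤ Rk F k₁ k₂ ℓ)
    (h₁ : ∀ (p : Fin k₁) (q : Fin k₂), Stab J (mono F (Sum.inl p) (Sum.inr q) 0 ℓ))
    (h₂ : ∀ (p : Fin k₁) (q : Fin k₂), Stab J (mono F (Sum.inr q) (Sum.inl p) 0 ℓ))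
    (h₃ : ∀ q : Fin k₂, ∃ r : Fin k₂, Stab J (mono F (Sum.inr r) (Sum.inr q) 0 (ℓ + 1)))
    (a b : Fin k₁ ⊕ Fin k₂) (m n : ℕ) (hn : ℓ ≤ n) : Stab J (mono F a b m n) := by
  let p₀ : Fin k₁ := ⟨0, hk₁⟩
  let q₀ : Fin k₂ := ⟨0, hk₂⟩
  have s₁ : ∀ n, ℓ ≤ n → ∀ (p : Fin k₁) (q : Fin k₂),
      Stab J (mono F (Sum.inl p) (Sum.inr q) 0 n) := by
    intro n hn
    induction n, hn using Nat.le_induction with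
    | base => exact h₁
    | succ n hn ih =>
      intro p q
      obtain ⟨r, hr⟩ := h₃ q
      have := Stab.right hJ hr (ih p r) (by omega) hn ℓ (n - ℓ) (by rw [d0_blk_inr]; omega)
        (Or.inl (by simp))
      rwa [show ℓ + 1 + (n - ℓ) = n + 1 by omega] at this
  -- Order ℓ + 2 is just above the bound ℓ + 1 of the right multiplication term, so p = s is
  -- allowed; the surplus m in the t₂-degree becomes t₁-degree.
  have s₂ : ∀ (m : ℕ) (p s : Fin k₁), Stab J (mono F (Sum.inl p) (Sum.inl s) m ℓ) := by
    intro m p s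
    have := Stab.left hJ (s₁ (m + ℓ + 2) (by omega) p q₀) (h₂ s q₀) (by omega) le_rfl (ℓ + 2) m
      (by rw [d0_blk_inr]; omega) (Or.inr (by rw [d0_blk_inl]; omega))
    rwa [zero_add] at this
  have s₃ : ∀ (m n : ℕ) (p : Fin k₁) (q : Fin k₂), ℓ ≤ n →
      Stab J (mono F (Sum.inl p) (Sum.inr q) m n) := fun m n p q hn =>
    Stab.left hJ (s₂ m p p) (s₁ n hn p q) le_rfl hn (ℓ + 1) 0 (by rw [d0_blk_inl])
      (Or.inl (by simp))
  -- Here the surplus sits in the t₁-degree m + n of the right factor: at order ℓ + n + 1 exactly m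
  -- of it survives.
  have s₄ : ∀ (m n : ℕ) (q r : Fin k₂), ℓ ≤ n →
      Stab J (mono F (Sum.inr q) (Sum.inr r) m n) := by
    intro m n q r hn
    have := Stab.left hJ (h₂ p₀ q) (s₃ (m + n) n p₀ r hn) le_rfl hn (ℓ + n + 1) m
      (by rw [d0_blk_inl]; omega) (Or.inr (by rw [d0_blk_inr]; omega))
    rwa [zero_add] at this
  have s₅ : ∀ (m : ℕ) (r : Fin k₂) (s : Fin k₁),
      Stab J (mono F (Sum.inr r) (Sum.inl s) m ℓ) := fun m r s =>
    Stab.left hJ (s₄ m ℓ r r le_rfl) (h₂ s r) le_rfl le_rfl ℓ 0 (by rw [d0_blk_inr])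
      (Or.inl (by simp))
  -- Right multiplication by an even element of t₁-degree n raises the t₂-degree from ℓ to n and
  -- keeps m.
  have s₆ : ∀ (m n : ℕ) (q : Fin k₂) (s : Fin k₁), ℓ ≤ n →
      Stab J (mono F (Sum.inr q) (Sum.inl s) m n) := by
    intro m n q s hn
    have := Stab.right hJ (s₂ n s s) (s₅ m q s) le_rfl le_rfl (ℓ + ℓ + 1) (n - ℓ)
      (by rw [d0_blk_inl]; omega) (Or.inl (by simp))
    rwa [Nat.add_sub_cancel' hn] at this
  rcases a with p | p <;> rcases b with s | s
  · exact Stab.left hJ (s₃ m (m + n + 2 + ℓ) p q₀ (by omega)) (s₆ 0 n q₀ s hn) (by omega) hn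
      (m + n + 2 + ℓ) 0 (by rw [d0_blk_inr]) (Or.inr (by rw [d0_blk_inl]; omega))
  · exact s₃ m n p s hn
  · exact s₆ m n p s hn
  · exact s₄ m n p s hn

theorem exists_stab_mono_succ (hk₁ : 0 < k₁) (hk : 2 < k₁ + k₂) (hJ : J ≤ Rk F k₁ k₂ ℓ)
    (h₁ : ∀ (p : Fin k₁) (q : Fin k₂), Stab J (mono F (Sum.inl p) (Sum.inr q) 0 ℓ))
    (h₂ : ∀ (p : Fin k₁) (q : Fin k₂), Stab J (mono F (Sum.inr q) (Sum.inl p) 0 ℓ))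
    (q : Fin k₂) : ∃ r : Fin k₂, Stab J (mono F (Sum.inr r) (Sum.inr q) 0 (ℓ + 1)) := by
  by_cases h : 1 < k₁
  -- Two distinct indices p, s of the first block give E_{p,s}, hence E_{p,q} with t₁-degree 1. That
  -- extra degree permits order ℓ + 1 in the last product, which removes the unwanted left
  -- multiplication term.
  · have hps : (⟨0, hk₁⟩ : Fin k₁) ≠ ⟨1, h⟩ := by simp
    generalize (⟨0, hk₁⟩ : Fin k₁) = p at hps
    generalize (⟨1, h⟩ : Fin k₁) = s at hps
    have e₁ := Stab.left hJ (h₁ p q) (h₂ s q) le_rfl le_rfl ℓ 0 (by rw [d0_blk_inr])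
      (Or.inl (by simpa using hps))
    have e₂ := Stab.left hJ e₁ (h₁ s q) le_rfl le_rfl ℓ 1 (by rw [d0_blk_inl]) (Or.inl (by simp))
    exact ⟨q, Stab.right hJ e₂ (h₂ p q) le_rfl le_rfl (ℓ + 1) 1 (by rw [d0_blk_inl]; omega)
      (Or.inr (by rw [d0_blk_inr]; omega))⟩
  -- Now k₁ = 1, so the second block has another index r, and q ≠ r alone removes the left
  -- multiplication term.
  · obtain ⟨r, hr⟩ : ∃ r : Fin k₂, q ≠ r := by
      have : Nontrivial (Fin k₂) := Fin.nontrivial_iff_two_le.2 (by omega)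
      exact (exists_ne q).imp fun _ h => h.symm
    exact ⟨r, Stab.right hJ (h₁ ⟨0, hk₁⟩ q) (h₂ ⟨0, hk₁⟩ r) le_rfl le_rfl ℓ 1
      (by rw [d0_blk_inl, zero_add]) (Or.inl (by simpa using hr))⟩

end Generation

end ConfSuper

theorem theorem4p1 (F : Type*) [Field F] [CharZero F] (k₁ k₂ : ℕ) (hk₁ : 0 < k₁) (hk₂ : 0 < k₂)
    (ℓ : ℕ) :
    IsConformalSuperalgebra (RkAlg F k₁ k₂ ℓ) ∧
    (RkAlg F k₁ k₂ ℓ).grade 1 ≠ ⊥ ∧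
    IsSimple (RkAlg F k₁ k₂ ℓ) ∧
    RkWeight F k₁ k₂ ℓ (ℓ + 3 / 2) =
      Submodule.span F
        ({x | ∃ (p : Fin k₁) (q : Fin k₂), x = RkElt F (Sum.inl p) (Sum.inr q) 0 ℓ le_rfl} ∪
         {x | ∃ (p : Fin k₁) (q : Fin k₂), x = RkElt F (Sum.inr q) (Sum.inl p) 0 ℓ le_rfl}) ∧
    (2 < k₁ + k₂ →
      GeneratedBy (RkAlg F k₁ k₂ ℓ) (RkWeight F k₁ k₂ ℓ (ℓ + 3 / 2) : Set (Rk F k₁ k₂ ℓ))) ∧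
    (k₁ + k₂ = 2 →
      GeneratedBy (RkAlg F k₁ k₂ ℓ)
        {RkElt F (Sum.inl ⟨0, hk₁⟩) (Sum.inr ⟨0, hk₂⟩) 0 ℓ le_rfl,
         RkElt F (Sum.inr ⟨0, hk₂⟩) (Sum.inl ⟨0, hk₁⟩) 0 ℓ le_rfl,
         RkElt F (Sum.inr ⟨0, hk₂⟩) (Sum.inr ⟨0, hk₂⟩) 0 (ℓ + 1) (Nat.le_succ ℓ)}) := by
  refine ⟨RkAlg_isConformalSuperalgebra F k₁ k₂ ℓ, RkAlg_grade_one_ne_bot F hk₁ hk₂ ℓ,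
    RkAlg_isSimple k₁ k₂ ℓ, RkWeight_eq_span k₁ k₂ ℓ, fun hk => ?_, fun hk => ?_⟩
  · refine generatedBy_of_stab _ ?_
    have hJ := Submodule.map_subtype_le (Rk F k₁ k₂ ℓ) (Submodule.span F
      (words (RkAlg F k₁ k₂ ℓ) (RkWeight F k₁ k₂ ℓ (ℓ + 3 / 2) : Set (Rk F k₁ k₂ ℓ))))
    have mem : ∀ x, x ∈ Submodule.span F _ → x ∈ RkWeight F k₁ k₂ ℓ (ℓ + 3 / 2) :=
      (RkWeight_eq_span (F := F) k₁ k₂ ℓ).ge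
    have h₁ := fun (p : Fin k₁) (q : Fin k₂) => stab_of_mem
      (RkWeight F k₁ k₂ ℓ (ℓ + 3 / 2) : Set (Rk F k₁ k₂ ℓ))
      (mem _ (Submodule.subset_span (Or.inl ⟨p, q, rfl⟩)))
    have h₂ := fun (p : Fin k₁) (q : Fin k₂) => stab_of_mem
      (RkWeight F k₁ k₂ ℓ (ℓ + 3 / 2) : Set (Rk F k₁ k₂ ℓ))
      (mem _ (Submodule.subset_span (Or.inr ⟨p, q, rfl⟩)))
    exact stab_mono_of_generators hk₁ hk₂ hJ h₁ h₂ (exists_stab_mono_succ hk₁ hk hJ h₁ h₂)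
  · refine generatedBy_of_stab _ ?_
    obtain ⟨rfl, rfl⟩ : k₁ = 1 ∧ k₂ = 1 := by omega
    have hp : ∀ p : Fin 1, p = ⟨0, one_pos⟩ := fun p => Subsingleton.elim _ _
    refine stab_mono_of_generators one_pos one_pos (Submodule.map_subtype_le _ _) ?_ ?_ ?_
    · intro p q
      rw [hp p, hp q]
      exact stab_of_mem (u := RkElt F (Sum.inl ⟨0, hk₁⟩) (Sum.inr ⟨0, hk₂⟩) 0 ℓ le_rfl) _ (Or.inl rfl)
    · intro p q
      rw [hp p, hp q]
      exact stab_of_mem (u := RkElt F (Sum.inr ⟨0, hk₂⟩) (Sum.inl ⟨0, hk₁⟩) 0 ℓ le_rfl) _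
        (Or.inr (Or.inl rfl))
    · intro q
      rw [hp q]
      exact ⟨⟨0, one_pos⟩, stab_of_mem (u := RkElt F (Sum.inr ⟨0, hk₂⟩) (Sum.inr ⟨0, hk₂⟩) 0 (ℓ + 1)
        (Nat.le_succ ℓ)) _ (Or.inr (Or.inr rfl))⟩
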